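/- Let $p\ge 1$ be an integer, $q=e^{2\pi i/p}$, $R=\mathbb C[z,z^{-1}]$, and let $\sigma$ be the $\mathbb C$-algebra automorphism of $R$ with $\sigma(z)=q^{-1}z$. Let $A(1)$ be the generalized Weyl algebra generated by $R$, $X$, $Y$ with $Xr=\sigma(r)X$, $Yr=\sigma^{-1}(r)Y$ for $r\in R$ and $XY=YX=1$; it is the skew Laurent polynomial ring $R[X,X^{-1};\sigma]$. Let $\omega=\{(z-q^k)\mid 0\le k<p\}$ be the $\sigma$-orbit of the maximal ideal $(z-1)$ of $R$. Consider the left $A(1)$-modules $M$ such that $M=\bigoplus_{\mathfrak m\in\operatorname{MaxSpec}R}M_{\mathfrak m}$ with $M_{\mathfrak m}=\{v\in M\mid \mathfrak m v=0\}$, every $M_{\mathfrak m}$ is finite dimensional over $R/\mathfrak m$, and $M_{\mathfrak m}=0$ unless $\mathfrak m\in\omega$. Let $\mathscr A^{\mathrm{split}}(\omega,\{1\})=\mathbb C\otimes_{\mathbb Z}K_0^{\mathrm{split}}$ be the complexified split Grothendieck group of these modules (so $[M\oplus N]=[M]+[N]$), made into a commutative $\mathbb C$-algebra by $[M][N]=[M\otimes_R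 N]$, where $X$ and $Y$ act on $M\otimes_R N$ by $X(v\otimes w)=Xv\otimes Xw$ and $Y(v\otimes w)=Yv\otimes Yw$. For $\xi\in\mathbb C^\times$ and $a\ge1$ let $u(\xi,a)$ be the class of the module with basis $e_{k,s}$ ($1\le k\le p$, $1\le s\le a$) on which $z e_{k,s}=q^k e_{k,s}$, $Xe_{k,s}=e_{k+1,s}$ for $k<p$, $Xe_{p,s}=\sum_{s'}F_{s's}e_{1,s'}$, and $Y$ acts by the inverse of $X$; here $F$ is the companion matrix of $(x-\xi)^a$. Then $\mathscr A^{\mathrm{split}}(\omega,\{1\})$ is generated as a $\mathbb C$-algebra by the elements $u(\xi,1)$, $\xi\in\mathbb C^\times$, together with $u(1,2)$, and as a commutative unital $\mathbb C$-algebra on these generators it is presented by the relations $$u(\xi,1)\,u(\eta,1)=u(\xi\eta,1)\quad(\xi,\eta\in\mathbb C^\times),\qquad u(1,1)=1 .$$ Equivalently, there is an isomorphism of $\mathbb C$-algebras from the polynomial ring $\mathbb C[\mathbb C^\times][x]$ in one variable over the group algebra of $\mathbb C^\times$ to $\mathscr A^{\mathrm{split}}(\omega,\{1\})$ that sends the group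 element $\xi$ to $u(\xi,1)$ and $x$ to $u(1,2)$. -/

import Mathlib

noncomputable section

open Submodule TensorProduct

universe u

/-! ### Generalized Weyl algebras of rank one -/

/-- Symbols generating a generalized Weyl algebra: one for each element of the
base ring, together with `X` and `Y`. -/
inductive GWAGen (R : Type u) : Type u
  | coeff (r : R)
  | X
  | Y

/-- The defining relations of the generalized Weyl algebra `A(R, σ, t)`. The first three say that
the base ring maps to it by a ring homomorphism. -/
inductive GWARel {R : Type u} [CommRing R] (σ : RingAut R) (t : R) :
    FreeAlgebra ℤ (GWAGen R) → FreeAlgebra ℤ (GWAGen R) → Prop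
  | add (r s : R) : GWARel σ t (FreeAlgebra.ι ℤ (.coeff (r + s)))
      (FreeAlgebra.ι ℤ (.coeff r) + FreeAlgebra.ι ℤ (.coeff s))
  | mul (r s : R) : GWARel σ t (FreeAlgebra.ι ℤ (.coeff (r * s)))
      (FreeAlgebra.ι ℤ (.coeff r) * FreeAlgebra.ι ℤ (.coeff s))
  | one : GWARel σ t (FreeAlgebra.ι ℤ (.coeff 1)) 1
  | X_coeff (r : R) : GWARel σ t (FreeAlgebra.ι ℤ .X * FreeAlgebra.ι ℤ (.coeff r))
      (FreeAlgebra.ι ℤ (.coeff (σ r)) * FreeAlgebra.ι ℤ .X)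
  | Y_coeff (r : R) : GWARel σ t (FreeAlgebra.ι ℤ .Y * FreeAlgebra.ι ℤ (.coeff r))
      (FreeAlgebra.ι ℤ (.coeff (σ.symm r)) * FreeAlgebra.ι ℤ .Y)
  | Y_X : GWARel σ t (FreeAlgebra.ι ℤ .Y * FreeAlgebra.ι ℤ .X) (FreeAlgebra.ι ℤ (.coeff t))
  | X_Y : GWARel σ t (FreeAlgebra.ι ℤ .X * FreeAlgebra.ι ℤ .Y) (FreeAlgebra.ι ℤ (.coeff (σ t)))

/-- The generalized Weyl algebra `A(R, σ, t)`. -/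
def GWA {R : Type u} [CommRing R] (σ : RingAut R) (t : R) : Type u :=
  RingQuot (GWARel σ t)

namespace GWA

variable {R : Type u} [CommRing R] (σ : RingAut R) (t : R)

instance : Ring (GWA σ t) := inferInstanceAs (Ring (RingQuot (GWARel σ t)))

/-- The canonical map from the free ring. -/
def mk : FreeAlgebra ℤ (GWAGen R) →+* GWA σ t := RingQuot.mkRingHom (GWARel σ t)

variable {σ t} in
theorem mk_rel {a b : FreeAlgebra ℤ (GWAGen R)} (h : GWARel σ t a b) : mk σ t a = mk σ t b :=
  RingQuot.mkRingHom_rel h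

theorem mk_surjective : Function.Surjective (mk σ t) := RingQuot.mkRingHom_surjective _

/-- The base ring maps to the generalized Weyl algebra. -/
def coeff : R →+* GWA σ t where
  toFun r := mk σ t (FreeAlgebra.ι ℤ (.coeff r))
  map_one' := by rw [mk_rel .one, map_one]
  map_mul' r s := by rw [mk_rel (.mul r s), map_mul]
  map_add' r s := by rw [mk_rel (.add r s), map_add]
  map_zero' := by
    have h := mk_rel (σ := σ) (t := t) (.add 0 0)
    rw [map_add, add_zero] at h
    exact left_eq_add.mp h

/-- The generator `X`. -/
def X : GWA σ t := mk σ t (FreeAlgebra.ι ℤ .X)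

/-- The generator `Y`. -/
def Y : GWA σ t := mk σ t (FreeAlgebra.ι ℤ .Y)

theorem X_mul_coeff (r : R) : X σ t * coeff σ t r = coeff σ t (σ r) * X σ t := by
  have := mk_rel (σ := σ) (t := t) (.X_coeff r)
  rwa [map_mul, map_mul] at this

theorem Y_mul_coeff (r : R) : Y σ t * coeff σ t r = coeff σ t (σ.symm r) * Y σ t := by
  have := mk_rel (σ := σ) (t := t) (.Y_coeff r)
  rwa [map_mul, map_mul] at this

theorem Y_mul_X : Y σ t * X σ t = coeff σ t t := by
  have := mk_rel (σ := σ) (t := t) .Y_X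
  rwa [map_mul] at this

theorem X_mul_Y : X σ t * Y σ t = coeff σ t (σ t) := by
  have := mk_rel (σ := σ) (t := t) .X_Y
  rwa [map_mul] at this

variable {σ t} in
/-- The generalized Weyl algebra is generated by the base ring, `X` and `Y`. -/
theorem induction {P : GWA σ t → Prop} (coeff : ∀ r, P (coeff σ t r)) (X : P (X σ t))
    (Y : P (Y σ t)) (add : ∀ a b, P a → P b → P (a + b)) (mul : ∀ a b, P a → P b → P (a * b))
    (a : GWA σ t) : P a := by
  obtain ⟨a, rfl⟩ := mk_surjective σ t a
  induction a using FreeAlgebra.induction with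
  | grade0 n =>
    have h : mk σ t (algebraMap ℤ _ n) = GWA.coeff σ t (n : R) := by simp
    rw [h]; exact coeff _
  | grade1 g => cases g with
    | coeff r => exact coeff r
    | X => exact X
    | Y => exact Y
  | mul a b ha hb => rw [map_mul]; exact mul _ _ ha hb
  | add a b ha hb => rw [map_add]; exact add _ _ ha hb

section lift

variable {σ t}
variable {S : Type*} [Ring S] (f : R →+* S) (x y : S)
  (hx : ∀ r, x * f r = f (σ r) * x) (hy : ∀ r, y * f r = f (σ.symm r) * y)
  (hyx : y * x = f t) (hxy : x * y = f (σ t))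

/-- The values of a ring homomorphism on the generators. -/
def genMap : GWAGen R → S
  | .coeff r => f r
  | .X => x
  | .Y => y

theorem genMap_rel (hx : ∀ r, x * f r = f (σ r) * x) (hy : ∀ r, y * f r = f (σ.symm r) * y)
    (hyx : y * x = f t) (hxy : x * y = f (σ t)) ⦃a b : FreeAlgebra ℤ (GWAGen R)⦄ (h : GWARel σ t a b) :
    (FreeAlgebra.lift ℤ (genMap f x y) : _ →+* S) a =
      (FreeAlgebra.lift ℤ (genMap f x y) : _ →+* S) b := by
  cases h <;> simp [genMap, hx, hy, hyx, hxy]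

/-- The universal property of the generalized Weyl algebra. -/
def lift : GWA σ t →+* S :=
  RingQuot.lift ⟨(FreeAlgebra.lift ℤ (genMap f x y) : _ →+* S), genMap_rel f x y hx hy hyx hxy⟩

theorem lift_mk (a : FreeAlgebra ℤ (GWAGen R)) :
    lift f x y hx hy hyx hxy (mk σ t a) = FreeAlgebra.lift ℤ (genMap f x y) a :=
  RingQuot.lift_mkRingHom_apply _ _ _

theorem lift_coeff (r : R) : lift f x y hx hy hyx hxy (coeff σ t r) = f r := by
  refine (lift_mk ..).trans ?_; simp [genMap]

theorem lift_X : lift f x y hx hy hyx hxy (X σ t) = x := by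
  refine (lift_mk ..).trans ?_; simp [genMap]

theorem lift_Y : lift f x y hx hy hyx hxy (Y σ t) = y := by
  refine (lift_mk ..).trans ?_; simp [genMap]

end lift

section module

variable {σ t}
variable {M : Type*} [AddCommGroup M] [Module R M] (x y : M →+ M)
  (hx : ∀ r v, x (r • v) = σ r • x v) (hy : ∀ r v, y (r • v) = σ.symm r • y v)
  (hyx : ∀ v, y (x v) = t • v) (hxy : ∀ v, x (y v) = σ t • v)

/-- Semilinear maps `x`, `y` on an `R`-module satisfying the defining relations make it a module
over the generalized Weyl algebra. -/
abbrev moduleOf : Module (GWA σ t) M :=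
  Module.compHom M
    (lift (S := AddMonoid.End M) (Module.toAddMonoidEnd R M) x y
      (fun r ↦ AddMonoidHom.ext (hx r)) (fun r ↦ AddMonoidHom.ext (hy r))
      (AddMonoidHom.ext hyx) (AddMonoidHom.ext hxy) : GWA σ t →+* AddMonoid.End M)

theorem moduleOf_coeff (r : R) (v : M) :
    letI := moduleOf x y hx hy hyx hxy; coeff σ t r • v = r • v :=
  DFunLike.congr_fun (lift_coeff (S := AddMonoid.End M) ..) v

theorem moduleOf_X (v : M) : letI := moduleOf x y hx hy hyx hxy; X σ t • v = x v :=
  DFunLike.congr_fun (lift_X (S := AddMonoid.End M) ..) v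

theorem moduleOf_Y (v : M) : letI := moduleOf x y hx hy hyx hxy; Y σ t • v = y v :=
  DFunLike.congr_fun (lift_Y (S := AddMonoid.End M) ..) v

end module

end GWA

/-! ### Weight modules supported on a finite orbit -/

/-- A finite orbit, with a chosen point, of the cyclic group generated by `σ` in the maximal
spectrum of `R`. -/
structure FiniteOrbit {R : Type u} [CommRing R] (σ : RingAut R) where
  carrier : Set (MaximalSpectrum R)
  base : MaximalSpectrum R
  mem_iff : ∀ m, m ∈ carrier ↔ ∃ i : ℤ, m.asIdeal = base.asIdeal.map (σ ^ i : RingAut R)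
  finite : carrier.Finite

/-- The weight space `M_𝔪 = {v ∈ M | 𝔪 v = 0}`. -/
abbrev weightSpace {R : Type u} [CommRing R] (M : Type u) [AddCommGroup M] [Module R M]
    (m : MaximalSpectrum R) : Submodule R M :=
  torsionBySet R M (m.asIdeal : Set R)

open Classical in
/-- `M` is the direct sum of its weight spaces, these are finite dimensional over the residue
fields, and all `𝔪` with `M_𝔪 ≠ 0` lie in `ω`. -/
structure IsWeight {R : Type u} [CommRing R] (ω : Set (MaximalSpectrum R))
    (M : Type u) [AddCommGroup M] [Module R M] : Prop where
  isInternal : DirectSum.IsInternal fun m : MaximalSpectrum R ↦ weightSpace M m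
  finite : ∀ m : MaximalSpectrum R, Module.Finite (R ⧸ m.asIdeal) (weightSpace M m)
  support : ∀ m : MaximalSpectrum R, weightSpace M m ≠ ⊥ → m ∈ ω

section IsWeight

variable {R : Type u} [CommRing R] {ω : Set (MaximalSpectrum R)}
  {M : Type u} [AddCommGroup M] [Module R M]

/-- The intersection of the maximal ideals in `ω`. -/
def idealOf (ω : Set (MaximalSpectrum R)) : Ideal R := ⨅ m ∈ ω, m.asIdeal

theorem mem_idealOf {r : R} : r ∈ idealOf ω ↔ ∀ m ∈ ω, r ∈ m.asIdeal := by
  simp [idealOf]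

theorem IsWeight.smul_eq_zero (h : IsWeight ω M) {r : R} (hr : r ∈ idealOf ω) (v : M) :
    r • v = 0 := by
  classical
  have htop : (⊤ : Submodule R M) ≤ torsionBySet R M (idealOf ω : Set R) := by
    rw [← h.isInternal.submodule_iSup_eq_top]
    refine iSup_le fun m ↦ ?_
    by_cases hm : weightSpace M m = ⊥
    · rw [hm]; exact bot_le
    · exact torsionBySet_le_torsionBySet_of_subset fun r hr ↦
        mem_idealOf.1 hr m (h.support m hm)
  exact (mem_torsionBySet_iff _ _).1 (htop (mem_top (x := v))) ⟨r, hr⟩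

theorem IsWeight.moduleFinite (h : IsWeight ω M) (hω : ω.Finite) : Module.Finite R M := by
  classical
  have htop : (⊤ : Submodule R M) = ⨆ m ∈ hω.toFinset, weightSpace M m := by
    rw [← h.isInternal.submodule_iSup_eq_top]
    refine le_antisymm (iSup_le fun m ↦ ?_) (iSup_le fun m ↦ iSup_le fun _ ↦ le_iSup _ m)
    by_cases hm : weightSpace M m = ⊥
    · rw [hm]; exact bot_le
    · exact le_biSup (fun m ↦ weightSpace M m) (hω.mem_toFinset.2 (h.support m hm))
  refine ⟨htop ▸ Submodule.fg_biSup _ _ fun m _ ↦ ?_⟩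
  have := h.finite m
  have : Module.Finite R (weightSpace M m) := Module.Finite.trans (R ⧸ m.asIdeal) _
  exact (Module.Finite.iff_fg).1 this

theorem sup_eq_top_of_ne {m n : MaximalSpectrum R} (h : m ≠ n) : m.asIdeal ⊔ n.asIdeal = ⊤ :=
  Ideal.IsMaximal.coprime_of_ne m.isMaximal n.isMaximal fun e ↦ h (MaximalSpectrum.ext e)

theorem isWeight_of (hω : ω.Finite) (h : ∀ r ∈ idealOf ω, ∀ v : M, r • v = 0)
    [Module.Finite R M] : IsWeight ω M := by
  classical
  have hind : iSupIndep fun m : MaximalSpectrum R ↦ weightSpace M m :=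
    iSupIndep_iff_supIndep.2 fun s ↦
      supIndep_torsionBySet_ideal (p := fun m : MaximalSpectrum R ↦ m.asIdeal)
        fun m _ n _ hmn ↦ sup_eq_top_of_ne hmn
  have htop' : ⨆ m ∈ hω.toFinset, weightSpace M m = ⊤ := by
    refine (iSup_torsionBySet_ideal_eq_torsionBySet_iInf
      (p := fun m : MaximalSpectrum R ↦ m.asIdeal)
      fun m _ n _ hmn ↦ sup_eq_top_of_ne hmn).trans ?_
    refine eq_top_iff.2 fun v _ ↦ (mem_torsionBySet_iff _ _).2 fun r ↦ h r ?_ v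
    have := r.2
    simpa [mem_idealOf] using this
  have htop : ⨆ m : MaximalSpectrum R, weightSpace M m = ⊤ :=
    eq_top_iff.2 (htop' ▸ iSup_le fun m ↦ iSup_le fun _ ↦ le_iSup (fun m ↦ weightSpace M m) m)
  refine ⟨DirectSum.isInternal_submodule_of_iSupIndep_of_iSup_eq_top hind htop, fun m ↦ ?_,
    fun m hm ↦ ?_⟩
  · have hc : IsCompl (⨆ (n) (_ : n ≠ m), weightSpace M n) (weightSpace M m) := by
      refine ⟨(hind m).symm, codisjoint_iff.2 (eq_top_iff.2 (htop ▸ iSup_le fun n ↦ ?_))⟩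
      by_cases hn : n = m
      · subst hn; exact le_sup_right
      · exact (le_biSup (fun n ↦ weightSpace M n) hn).trans le_sup_left
    have : Module.Finite R (weightSpace M m) :=
      Module.Finite.equiv (quotientEquivOfIsCompl _ _ hc)
    exact Module.Finite.of_restrictScalars_finite R (R ⧸ m.asIdeal) _
  · by_contra hmω
    refine hm (eq_bot_iff.2 ?_)
    have hd := hind m
    refine hd le_rfl ?_
    refine le_top.trans (htop'.symm.le.trans (iSup_le fun n ↦ iSup_le fun hn ↦ ?_))
    exact le_biSup (fun n ↦ weightSpace M n)
      (fun e ↦ hmω (e ▸ hω.mem_toFinset.1 hn) : n ≠ m)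

end IsWeight

/-- The objects of the category of weight modules over the generalized Weyl algebra `A(R, σ, t)`
with finite dimensional weight spaces and with support in `ω`. -/
structure WeightModule {R : Type u} [CommRing R] (σ : RingAut R) (t : R)
    (ω : Set (MaximalSpectrum R)) : Type (u + 1) where
  carrier : Type u
  [addCommGroup : AddCommGroup carrier]
  [moduleBase : Module R carrier]
  [module : Module (GWA σ t) carrier]
  /-- The `R`-module structure is the restriction of the module structure. -/
  coeff_smul : ∀ (r : R) (v : carrier), GWA.coeff σ t r • v = r • v
  isWeight : IsWeight ω carrier

namespace WeightModule

variable {R : Type u} [CommRing R] {σ : RingAut R}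

attribute [instance] addCommGroup moduleBase module

section basic

variable {t : R} {ω : Set (MaximalSpectrum R)}

theorem X_smul_smul (M : WeightModule σ t ω) (r : R) (v : M.carrier) :
    GWA.X σ t • r • v = σ r • GWA.X σ t • v := by
  rw [← M.coeff_smul, ← M.coeff_smul, ← mul_smul, ← mul_smul, GWA.X_mul_coeff]

theorem Y_smul_smul (M : WeightModule σ t ω) (r : R) (v : M.carrier) :
    GWA.Y σ t • r • v = σ.symm r • GWA.Y σ t • v := by
  rw [← M.coeff_smul, ← M.coeff_smul, ← mul_smul, ← mul_smul, GWA.Y_mul_coeff]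

theorem Y_smul_X_smul (M : WeightModule σ t ω) (v : M.carrier) :
    GWA.Y σ t • GWA.X σ t • v = t • v := by
  rw [← M.coeff_smul, ← mul_smul, GWA.Y_mul_X]

theorem X_smul_Y_smul (M : WeightModule σ t ω) (v : M.carrier) :
    GWA.X σ t • GWA.Y σ t • v = σ t • v := by
  rw [← M.coeff_smul, ← mul_smul, GWA.X_mul_Y]

/-- Semilinear maps `x`, `y` on a suitable `R`-module define a weight module. -/
@[simps carrier]
def of (M : Type u) [AddCommGroup M] [Module R M] (x y : M →+ M)
    (hx : ∀ r v, x (r • v) = σ r • x v) (hy : ∀ r v, y (r • v) = σ.symm r • y v)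
    (hyx : ∀ v, y (x v) = t • v) (hxy : ∀ v, x (y v) = σ t • v) (h : IsWeight ω M) :
    WeightModule σ t ω :=
  letI := GWA.moduleOf x y hx hy hyx hxy
  { carrier := M
    coeff_smul := GWA.moduleOf_coeff x y hx hy hyx hxy
    isWeight := h }

theorem of_X_smul (M : Type u) [AddCommGroup M] [Module R M] (x y : M →+ M)
    (hx : ∀ r v, x (r • v) = σ r • x v) (hy : ∀ r v, y (r • v) = σ.symm r • y v)
    (hyx : ∀ v, y (x v) = t • v) (hxy : ∀ v, x (y v) = σ t • v) (h : IsWeight ω M)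
    (v : (of M x y hx hy hyx hxy h).carrier) : GWA.X σ t • v = (x (v : M) : M) :=
  GWA.moduleOf_X (M := M) x y hx hy hyx hxy v

theorem of_Y_smul (M : Type u) [AddCommGroup M] [Module R M] (x y : M →+ M)
    (hx : ∀ r v, x (r • v) = σ r • x v) (hy : ∀ r v, y (r • v) = σ.symm r • y v)
    (hyx : ∀ v, y (x v) = t • v) (hxy : ∀ v, x (y v) = σ t • v) (h : IsWeight ω M)
    (v : (of M x y hx hy hyx hxy h).carrier) : GWA.Y σ t • v = (y (v : M) : M) :=
  GWA.moduleOf_Y (M := M) x y hx hy hyx hxy v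

/-- Isomorphism of weight modules: a bijective `A(R, σ, t)`-linear map. -/
def Iso (M N : WeightModule σ t ω) : Prop := Nonempty (M.carrier ≃ₗ[GWA σ t] N.carrier)

/-- A bijective additive map compatible with `R`, `X` and `Y` is an isomorphism. -/
theorem Iso.of_addEquiv {M N : WeightModule σ t ω} (e : M.carrier ≃+ N.carrier)
    (hr : ∀ (r : R) v, e (r • v) = r • e v) (hX : ∀ v, e (GWA.X σ t • v) = GWA.X σ t • e v)
    (hY : ∀ v, e (GWA.Y σ t • v) = GWA.Y σ t • e v) : Iso M N := by
  refine ⟨{ e with map_smul' := fun a v ↦ ?_ }⟩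
  change e (a • v) = a • e v
  induction a using GWA.induction generalizing v with
  | coeff r => rw [M.coeff_smul, N.coeff_smul, hr]
  | X => exact hX v
  | Y => exact hY v
  | add a b ha hb => rw [add_smul, add_smul, map_add, ha, hb]
  | mul a b ha hb => rw [mul_smul, mul_smul, ha, hb]

/-- An isomorphism is `R`-linear. -/
theorem equiv_smul {M N : WeightModule σ t ω} (e : M.carrier ≃ₗ[GWA σ t] N.carrier) (r : R)
    (v : M.carrier) : e (r • v) = r • e v := by
  rw [← M.coeff_smul, ← N.coeff_smul, map_smul]

instance setoid (σ : RingAut R) (t : R) (ω : Set (MaximalSpectrum R)) :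
    Setoid (WeightModule σ t ω) where
  r := Iso
  iseqv := ⟨fun _ ↦ ⟨.refl _ _⟩, fun ⟨e⟩ ↦ ⟨e.symm⟩, fun ⟨e⟩ ⟨f⟩ ↦ ⟨e.trans f⟩⟩

end basic

section operations

variable {ω : FiniteOrbit σ} {t s r : R}

/-- The direct sum of two weight modules. -/
def directSum (M N : WeightModule σ t ω.carrier) : WeightModule σ t ω.carrier where
  carrier := M.carrier × N.carrier
  coeff_smul r v := Prod.ext (M.coeff_smul r v.1) (N.coeff_smul r v.2)
  isWeight := by
    have := M.isWeight.moduleFinite ω.finite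
    have := N.isWeight.moduleFinite ω.finite
    exact isWeight_of ω.finite fun r hr v ↦
      Prod.ext (M.isWeight.smul_eq_zero hr v.1) (N.isWeight.smul_eq_zero hr v.2)

/-- The zero module. -/
def zero (σ : RingAut R) (t : R) (ω : FiniteOrbit σ) : WeightModule σ t ω.carrier where
  carrier := PUnit
  coeff_smul _ _ := rfl
  isWeight := isWeight_of ω.finite fun _ _ _ ↦ rfl

/-- For additive maps `f` and `g` that are semilinear with respect to the same automorphism,
the additive map `v ⊗ w ↦ f v ⊗ g w`. -/
def diagonal {M N : Type u} [AddCommGroup M] [Module R M] [AddCommGroup N] [Module R N]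
    (τ : RingAut R) (f : M →+ M) (g : N →+ N) (hf : ∀ (r : R) v, f (r • v) = τ r • f v)
    (hg : ∀ (r : R) v, g (r • v) = τ r • g v) : M ⊗[R] N →+ M ⊗[R] N :=
  TensorProduct.liftAddHom
    (AddMonoidHom.mk' (fun v ↦ AddMonoidHom.mk' (fun w ↦ f v ⊗ₜ[R] g w)
      fun _ _ ↦ by rw [map_add, tmul_add])
      fun _ _ ↦ AddMonoidHom.ext fun _ ↦ by simp [add_tmul])
    fun r v w ↦ by simp [hf, hg, smul_tmul]

theorem diagonal_tmul {M N : Type u} [AddCommGroup M] [Module R M] [AddCommGroup N] [Module R N]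
    (τ : RingAut R) (f : M →+ M) (g : N →+ N) (hf : ∀ (r : R) v, f (r • v) = τ r • f v)
    (hg : ∀ (r : R) v, g (r • v) = τ r • g v) (v : M) (w : N) :
    diagonal τ f g hf hg (v ⊗ₜ w) = f v ⊗ₜ g w := rfl

theorem diagonal_smul {M N : Type u} [AddCommGroup M] [Module R M] [AddCommGroup N] [Module R N]
    (τ : RingAut R) (f : M →+ M) (g : N →+ N) (hf : ∀ (r : R) v, f (r • v) = τ r • f v)
    (hg : ∀ (r : R) v, g (r • v) = τ r • g v) (r : R) (v : M ⊗[R] N) :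
    diagonal τ f g hf hg (r • v) = τ r • diagonal τ f g hf hg v := by
  induction v using TensorProduct.induction_on with
  | zero => simp
  | tmul v w => rw [smul_tmul', diagonal_tmul, diagonal_tmul, hf, smul_tmul']
  | add v w hv hw => rw [smul_add, map_add, hv, hw, map_add, smul_add]

/-- The action of `X` as an additive map. -/
def actX (M : WeightModule σ t ω.carrier) : M.carrier →+ M.carrier :=
  DistribSMul.toAddMonoidHom _ (GWA.X σ t)

/-- The action of `Y` as an additive map. -/
def actY (M : WeightModule σ t ω.carrier) : M.carrier →+ M.carrier :=
  DistribSMul.toAddMonoidHom _ (GWA.Y σ t)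

theorem actX_smul (M : WeightModule σ t ω.carrier) (r : R) (v : M.carrier) :
    M.actX (r • v) = σ r • M.actX v := M.X_smul_smul r v

theorem actY_smul (M : WeightModule σ t ω.carrier) (r : R) (v : M.carrier) :
    M.actY (r • v) = σ.symm r • M.actY v := M.Y_smul_smul r v

theorem actY_actX (M : WeightModule σ t ω.carrier) (v : M.carrier) :
    M.actY (M.actX v) = t • v := M.Y_smul_X_smul v

theorem actX_actY (M : WeightModule σ t ω.carrier) (v : M.carrier) :
    M.actX (M.actY v) = σ t • v := M.X_smul_Y_smul v

/-- The tensor product over `R` of a weight module over `A(R, σ, t)` and a weight module over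
`A(R, σ, s)`. It is a weight module over `A(R, σ, t s)`, on which `X` and `Y` act
by `X ⊗ X` and `Y ⊗ Y`. -/
def tensor (M : WeightModule σ t ω.carrier) (N : WeightModule σ s ω.carrier) (h : t * s = r) :
    WeightModule σ r ω.carrier :=
  of (M.carrier ⊗[R] N.carrier)
    (diagonal σ M.actX N.actX M.actX_smul N.actX_smul)
    (diagonal σ.symm M.actY N.actY M.actY_smul N.actY_smul)
    (fun _ _ ↦ diagonal_smul ..) (fun _ _ ↦ diagonal_smul ..)
    (fun v ↦ by
      induction v using TensorProduct.induction_on with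
      | zero => simp
      | tmul v w =>
        rw [diagonal_tmul, diagonal_tmul, actY_actX, actY_actX, smul_tmul_smul, h]
      | add v w hv hw => rw [map_add, map_add, hv, hw, smul_add])
    (fun v ↦ by
      induction v using TensorProduct.induction_on with
      | zero => simp
      | tmul v w =>
        rw [diagonal_tmul, diagonal_tmul, actX_actY, actX_actY, smul_tmul_smul, ← map_mul, h]
      | add v w hv hw => rw [map_add, map_add, hv, hw, smul_add])
    (by
      have := M.isWeight.moduleFinite ω.finite
      have := N.isWeight.moduleFinite ω.finite
      refine isWeight_of ω.finite fun r hr v ↦ ?_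
      induction v using TensorProduct.induction_on with
      | zero => simp
      | tmul v w => rw [smul_tmul', M.isWeight.smul_eq_zero hr, zero_tmul]
      | add v w hv hw => rw [smul_add, hv, hw, add_zero])

/-- The element `v ⊗ w` of the tensor product of two weight modules. -/
def tmul (M : WeightModule σ t ω.carrier) (N : WeightModule σ s ω.carrier) (h : t * s = r)
    (v : M.carrier) (w : N.carrier) : (M.tensor N h).carrier := v ⊗ₜ[R] w

theorem X_smul_tmul (M : WeightModule σ t ω.carrier) (N : WeightModule σ s ω.carrier)
    (h : t * s = r) (v : M.carrier) (w : N.carrier) :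
    GWA.X σ r • tmul M N h v w = tmul M N h (GWA.X σ t • v) (GWA.X σ s • w) :=
  of_X_smul ..

theorem Y_smul_tmul (M : WeightModule σ t ω.carrier) (N : WeightModule σ s ω.carrier)
    (h : t * s = r) (v : M.carrier) (w : N.carrier) :
    GWA.Y σ r • tmul M N h v w = tmul M N h (GWA.Y σ t • v) (GWA.Y σ s • w) :=
  of_Y_smul ..

theorem tensor_induction {M : WeightModule σ t ω.carrier} {N : WeightModule σ s ω.carrier}
    {h : t * s = r} {P : (M.tensor N h).carrier → Prop}
    (zero : P 0) (tmul : ∀ v w, P (tmul M N h v w)) (add : ∀ a b, P a → P b → P (a + b))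
    (a : (M.tensor N h).carrier) : P a :=
  TensorProduct.induction_on (motive := P) a zero tmul add

theorem tmul_add_left {M : WeightModule σ t ω.carrier} {N : WeightModule σ s ω.carrier}
    {h : t * s = r} (v v' : M.carrier) (w : N.carrier) :
    tmul M N h (v + v') w = tmul M N h v w + tmul M N h v' w := TensorProduct.add_tmul ..

theorem tmul_zero_left {M : WeightModule σ t ω.carrier} {N : WeightModule σ s ω.carrier}
    {h : t * s = r} (w : N.carrier) : tmul M N h 0 w = 0 := TensorProduct.zero_tmul ..

/-- An `R`-linear bijection out of a tensor product that commutes with `X` and `Y` on pure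
tensors is an isomorphism. -/
theorem Iso.of_tensor {M : WeightModule σ t ω.carrier} {N : WeightModule σ s ω.carrier}
    {h : t * s = r} {K : WeightModule σ r ω.carrier}
    (e : (M.tensor N h).carrier ≃ₗ[R] K.carrier)
    (hX : ∀ v w, e (tmul M N h (GWA.X σ t • v) (GWA.X σ s • w)) = GWA.X σ r • e (tmul M N h v w))
    (hY : ∀ v w, e (tmul M N h (GWA.Y σ t • v) (GWA.Y σ s • w)) = GWA.Y σ r • e (tmul M N h v w)) :
    Iso (M.tensor N h) K := by
  refine Iso.of_addEquiv e.toAddEquiv (fun r v ↦ e.map_smul r v) (fun v ↦ ?_) fun v ↦ ?_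
  · induction v using tensor_induction with
    | zero => rw [smul_zero, map_zero, smul_zero]
    | tmul v w => rw [X_smul_tmul]; exact hX v w
    | add v w hv hw => rw [smul_add, map_add, map_add, smul_add, hv, hw]
  · induction v using tensor_induction with
    | zero => rw [smul_zero, map_zero, smul_zero]
    | tmul v w => rw [Y_smul_tmul]; exact hY v w
    | add v w hv hw => rw [smul_add, map_add, map_add, smul_add, hv, hw]

/-- An isomorphism of weight modules as an `R`-linear bijection. -/
def baseEquiv {M N : WeightModule σ t ω.carrier} (e : M.carrier ≃ₗ[GWA σ t] N.carrier) :
    M.carrier ≃ₗ[R] N.carrier :=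
  { e.toAddEquiv with map_smul' := equiv_smul e }

theorem tensor_congr {M M' : WeightModule σ t ω.carrier} {N N' : WeightModule σ s ω.carrier}
    (h : t * s = r) : Iso M M' → Iso N N' → Iso (M.tensor N h) (M'.tensor N' h) := by
  rintro ⟨e⟩ ⟨f⟩
  refine Iso.of_tensor (K := M'.tensor N' h) (TensorProduct.congr (baseEquiv e) (baseEquiv f))
    (fun v w ↦ ?_) fun v w ↦ ?_
  · refine Eq.trans ?_ (X_smul_tmul M' N' h (e v) (f w)).symm
    exact congrArg₂ (tmul M' N' h) (map_smul e _ v) (map_smul f _ w)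
  · refine Eq.trans ?_ (Y_smul_tmul M' N' h (e v) (f w)).symm
    exact congrArg₂ (tmul M' N' h) (map_smul e _ v) (map_smul f _ w)

theorem directSum_congr {M M' N N' : WeightModule σ t ω.carrier} :
    Iso M M' → Iso N N' → Iso (M.directSum N) (M'.directSum N') := by
  rintro ⟨e⟩ ⟨f⟩
  exact ⟨LinearEquiv.prodCongr e f⟩

theorem directSum_comm (M N : WeightModule σ t ω.carrier) :
    Iso (M.directSum N) (N.directSum M) :=
  ⟨LinearEquiv.prodComm _ _ _⟩

theorem directSum_assoc (M N K : WeightModule σ t ω.carrier) :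
    Iso ((M.directSum N).directSum K) (M.directSum (N.directSum K)) :=
  ⟨LinearEquiv.prodAssoc _ _ _ _⟩

theorem zero_directSum (M : WeightModule σ t ω.carrier) :
    Iso ((zero σ t ω).directSum M) M :=
  have : Unique (zero σ t ω).carrier := inferInstanceAs (Unique PUnit)
  ⟨LinearEquiv.uniqueProd⟩

theorem tensor_comm (M : WeightModule σ t ω.carrier) (N : WeightModule σ s ω.carrier)
    (h : t * s = r) (h' : s * t = r) : Iso (M.tensor N h) (N.tensor M h') :=
  Iso.of_tensor (K := N.tensor M h') (TensorProduct.comm R _ _)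
    (fun v w ↦ (X_smul_tmul N M h' w v).symm) (fun v w ↦ (Y_smul_tmul N M h' w v).symm)

/-- The associativity of the tensor product. -/
def assocEquiv {t₁ t₂ t₃ t₁₂ t₂₃ : R} (M : WeightModule σ t₁ ω.carrier)
    (N : WeightModule σ t₂ ω.carrier) (K : WeightModule σ t₃ ω.carrier) (h₁ : t₁ * t₂ = t₁₂)
    (h₂ : t₁₂ * t₃ = r) (h₃ : t₂ * t₃ = t₂₃) (h₄ : t₁ * t₂₃ = r) :
    ((M.tensor N h₁).tensor K h₂).carrier ≃ₗ[R] (M.tensor (N.tensor K h₃) h₄).carrier :=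
  TensorProduct.assoc R M.carrier N.carrier K.carrier

theorem assocEquiv_tmul {t₁ t₂ t₃ t₁₂ t₂₃ : R} (M : WeightModule σ t₁ ω.carrier)
    (N : WeightModule σ t₂ ω.carrier) (K : WeightModule σ t₃ ω.carrier) (h₁ : t₁ * t₂ = t₁₂)
    (h₂ : t₁₂ * t₃ = r) (h₃ : t₂ * t₃ = t₂₃) (h₄ : t₁ * t₂₃ = r) (v : M.carrier) (w : N.carrier)
    (x : K.carrier) :
    assocEquiv M N K h₁ h₂ h₃ h₄ (tmul (M.tensor N h₁) K h₂ (tmul M N h₁ v w) x) =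
      tmul M (N.tensor K h₃) h₄ v (tmul N K h₃ w x) := rfl

theorem tensor_assoc {t₁ t₂ t₃ t₁₂ t₂₃ : R} (M : WeightModule σ t₁ ω.carrier)
    (N : WeightModule σ t₂ ω.carrier) (K : WeightModule σ t₃ ω.carrier) (h₁ : t₁ * t₂ = t₁₂)
    (h₂ : t₁₂ * t₃ = r) (h₃ : t₂ * t₃ = t₂₃) (h₄ : t₁ * t₂₃ = r) :
    Iso ((M.tensor N h₁).tensor K h₂) (M.tensor (N.tensor K h₃) h₄) := by
  refine Iso.of_tensor (assocEquiv M N K h₁ h₂ h₃ h₄) (fun v w ↦ ?_) fun v w ↦ ?_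
  · induction v using tensor_induction with
    | zero => rw [smul_zero, tmul_zero_left, tmul_zero_left, map_zero, smul_zero]
    | tmul v v' => simp only [X_smul_tmul, assocEquiv_tmul]
    | add v v' hv hw =>
      rw [smul_add, tmul_add_left, tmul_add_left, map_add, map_add, smul_add, hv, hw]
  · induction v using tensor_induction with
    | zero => rw [smul_zero, tmul_zero_left, tmul_zero_left, map_zero, smul_zero]
    | tmul v v' => simp only [Y_smul_tmul, assocEquiv_tmul]
    | add v v' hv hw =>
      rw [smul_add, tmul_add_left, tmul_add_left, map_add, map_add, smul_add, hv, hw]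

theorem zero_tensor (N : WeightModule σ s ω.carrier) (h : t * s = r) :
    Iso ((zero σ t ω).tensor N h) (zero σ r ω) := by
  have key : ∀ a : ((zero σ t ω).tensor N h).carrier, a = 0 := fun a ↦ by
    induction a using tensor_induction with
    | zero => rfl
    | tmul v w => exact tmul_zero_left w
    | add v w hv hw => rw [hv, hw, add_zero]
  exact Iso.of_tensor
    { toFun := fun _ ↦ 0, invFun := fun _ ↦ 0, map_add' := fun _ _ ↦ rfl,
      map_smul' := fun _ _ ↦ rfl, left_inv := fun a ↦ (key a).symm,
      right_inv := fun _ ↦ rfl } (fun _ _ ↦ rfl) (fun _ _ ↦ rfl)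

theorem directSum_tensor (M M' : WeightModule σ t ω.carrier) (N : WeightModule σ s ω.carrier)
    (h : t * s = r) :
    Iso ((M.directSum M').tensor N h) ((M.tensor N h).directSum (M'.tensor N h)) :=
  Iso.of_tensor (M := M.directSum M') (K := (M.tensor N h).directSum (M'.tensor N h))
    (TensorProduct.prodLeft R R M.carrier M'.carrier N.carrier)
    (fun v w ↦ Prod.ext (X_smul_tmul M N h v.1 w).symm (X_smul_tmul M' N h v.2 w).symm)
    (fun v w ↦ Prod.ext (Y_smul_tmul M N h v.1 w).symm (Y_smul_tmul M' N h v.2 w).symm)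

section unit

theorem map_mem_idealOf (ω : FiniteOrbit σ) (i : ℤ) {r : R} (hr : r ∈ idealOf ω.carrier) :
    (σ ^ i) r ∈ idealOf ω.carrier := by
  rw [mem_idealOf] at hr ⊢
  intro m hm
  obtain ⟨j, hj⟩ := (ω.mem_iff m).1 hm
  let n : MaximalSpectrum R := ⟨ω.base.asIdeal.map (σ ^ (j - i) : RingAut R),
    Ideal.map_isMaximal_of_equiv _⟩
  have hn : r ∈ ω.base.asIdeal.map (σ ^ (j - i) : RingAut R) :=
    hr n ((ω.mem_iff n).2 ⟨j - i, rfl⟩)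
  rw [hj]
  obtain ⟨x, hx, rfl⟩ := (Ideal.mem_map_of_equiv _ _).1 hn
  refine (Ideal.mem_map_of_equiv _ _).2 ⟨x, hx, ?_⟩
  rw [← RingAut.mul_apply, ← zpow_add]
  congr 1
  group

/-- The ring endomorphism of `R ⧸ I` induced by `σ`, where `I` is the intersection of the maximal
ideals in the orbit. -/
def quotX (ω : FiniteOrbit σ) : R ⧸ idealOf ω.carrier →+* R ⧸ idealOf ω.carrier :=
  Ideal.quotientMap _ (σ : R →+* R) fun r hr ↦ by
    simpa using map_mem_idealOf ω 1 hr

/-- The ring endomorphism of `R ⧸ I` induced by the inverse of `σ`. -/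
def quotY (ω : FiniteOrbit σ) : R ⧸ idealOf ω.carrier →+* R ⧸ idealOf ω.carrier :=
  Ideal.quotientMap _ (σ.symm : R →+* R) fun r hr ↦ by
    simpa using map_mem_idealOf ω (-1) hr

/-- The unit for the tensor product: the `R`-module `R ⧸ I`, where `I` is the intersection of the
maximal ideals in the orbit, with `X` acting by `σ`. -/
def unit (ω : FiniteOrbit σ) : WeightModule σ 1 ω.carrier :=
  of (R ⧸ idealOf ω.carrier) (quotX ω).toAddMonoidHom (quotY ω).toAddMonoidHom
    (fun r v ↦ by
      obtain ⟨v, rfl⟩ := Ideal.Quotient.mk_surjective v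
      simp [quotX, Algebra.smul_def, ← map_mul])
    (fun r v ↦ by
      obtain ⟨v, rfl⟩ := Ideal.Quotient.mk_surjective v
      simp [quotY, Algebra.smul_def, ← map_mul])
    (fun v ↦ by
      obtain ⟨v, rfl⟩ := Ideal.Quotient.mk_surjective v
      simp [quotX, quotY])
    (fun v ↦ by
      obtain ⟨v, rfl⟩ := Ideal.Quotient.mk_surjective v
      simp [quotX, quotY])
    (isWeight_of ω.finite fun r hr v ↦ by
      rw [Algebra.smul_def, Ideal.Quotient.algebraMap_eq, Ideal.Quotient.eq_zero_iff_mem.2 hr,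
        zero_mul])

/-- The class of an element of `R` in the unit. -/
def toUnit (ω : FiniteOrbit σ) (r : R) : (unit ω).carrier := Ideal.Quotient.mk _ r

theorem X_smul_toUnit (ω : FiniteOrbit σ) (r : R) :
    GWA.X σ 1 • toUnit ω r = toUnit ω (σ r) := of_X_smul ..

theorem Y_smul_toUnit (ω : FiniteOrbit σ) (r : R) :
    GWA.Y σ 1 • toUnit ω r = toUnit ω (σ.symm r) := of_Y_smul ..

/-- The canonical map of the tensor product with the unit. -/
def unitEquiv (N : WeightModule σ t ω.carrier) :
    ((unit ω).tensor N (one_mul t)).carrier ≃ₗ[R] N.carrier :=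
  let f : (R ⧸ idealOf ω.carrier) →ₗ[R] N.carrier →ₗ[R] N.carrier :=
    Submodule.liftQ (idealOf ω.carrier) (LinearMap.lsmul R N.carrier) fun r hr ↦
      LinearMap.ext fun v ↦ N.isWeight.smul_eq_zero hr v
  LinearEquiv.ofLinearMap (M := (R ⧸ idealOf ω.carrier) ⊗[R] N.carrier) (TensorProduct.lift f)
    (TensorProduct.mk R (R ⧸ idealOf ω.carrier) N.carrier 1)
    (LinearMap.ext fun v ↦ one_smul R v)
    (TensorProduct.ext' fun r v ↦ by
      obtain ⟨r, rfl⟩ := Ideal.Quotient.mk_surjective r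
      change (1 : R ⧸ idealOf ω.carrier) ⊗ₜ[R] (r • v) = _
      rw [tmul_smul, smul_tmul', Algebra.smul_def, mul_one]
      rfl)

theorem unitEquiv_tmul (N : WeightModule σ t ω.carrier) (r : R) (v : N.carrier) :
    unitEquiv N (tmul _ _ (one_mul t) (toUnit ω r) v) = r • v := rfl

theorem unit_tensor (N : WeightModule σ t ω.carrier) :
    Iso ((unit ω).tensor N (one_mul t)) N := by
  refine Iso.of_tensor (unitEquiv N) (fun v w ↦ ?_) fun v w ↦ ?_
  · obtain ⟨r, rfl⟩ : ∃ r, toUnit ω r = v := Ideal.Quotient.mk_surjective v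
    rw [X_smul_toUnit, unitEquiv_tmul, unitEquiv_tmul, X_smul_smul]
  · obtain ⟨r, rfl⟩ : ∃ r, toUnit ω r = v := Ideal.Quotient.mk_surjective v
    rw [Y_smul_toUnit, unitEquiv_tmul, unitEquiv_tmul, Y_smul_smul]

end unit

end operations

end WeightModule

/-! ### The split Grothendieck ring -/

/-- Isomorphism classes of weight modules over `A(R, σ, 1)` with support in the orbit `ω`. -/
def IsoClass {R : Type u} [CommRing R] {σ : RingAut R} (ω : FiniteOrbit σ) : Type (u + 1) :=
  Quotient (WeightModule.setoid σ 1 ω.carrier)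

namespace IsoClass

open WeightModule

variable {R : Type u} [CommRing R] {σ : RingAut R} (ω : FiniteOrbit σ)

variable {ω} in
/-- The isomorphism class of a module. -/
def mk (M : WeightModule σ 1 ω.carrier) : IsoClass ω := Quotient.mk _ M

variable {ω} in
theorem mk_eq_mk {M N : WeightModule σ 1 ω.carrier} : mk M = mk N ↔ Iso M N := Quotient.eq

/-- Addition is induced by the direct sum. -/
instance : Add (IsoClass ω) :=
  ⟨Quotient.map₂ directSum fun _ _ h _ _ h' ↦ directSum_congr h h'⟩

/-- Multiplication is induced by the tensor product over `R`. -/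
instance : Mul (IsoClass ω) :=
  ⟨Quotient.map₂ (fun M N ↦ M.tensor N (one_mul 1)) fun _ _ h _ _ h' ↦ tensor_congr _ h h'⟩

instance : Zero (IsoClass ω) := ⟨mk (zero σ 1 ω)⟩

instance : One (IsoClass ω) := ⟨mk (unit ω)⟩

theorem mul_comm' (a b : IsoClass ω) : a * b = b * a := by
  induction a using Quotient.inductionOn
  induction b using Quotient.inductionOn
  exact mk_eq_mk.2 (tensor_comm ..)

theorem one_mul' (a : IsoClass ω) : 1 * a = a := by
  induction a using Quotient.inductionOn
  exact mk_eq_mk.2 (unit_tensor _)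

theorem zero_mul' (a : IsoClass ω) : 0 * a = 0 := by
  induction a using Quotient.inductionOn
  exact mk_eq_mk.2 (zero_tensor ..)

theorem add_mul' (a b c : IsoClass ω) : (a + b) * c = a * c + b * c := by
  induction a using Quotient.inductionOn
  induction b using Quotient.inductionOn
  induction c using Quotient.inductionOn
  exact mk_eq_mk.2 (directSum_tensor ..)

theorem add_comm' (a b : IsoClass ω) : a + b = b + a := by
  induction a using Quotient.inductionOn
  induction b using Quotient.inductionOn
  exact mk_eq_mk.2 (directSum_comm ..)

theorem zero_add' (a : IsoClass ω) : 0 + a = a := by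
  induction a using Quotient.inductionOn
  exact mk_eq_mk.2 (zero_directSum _)

instance : CommSemiring (IsoClass ω) where
  add_assoc a b c := by
    induction a using Quotient.inductionOn
    induction b using Quotient.inductionOn
    induction c using Quotient.inductionOn
    exact mk_eq_mk.2 (directSum_assoc ..)
  zero_add := zero_add' ω
  add_zero a := by rw [add_comm', zero_add']
  add_comm := add_comm' ω
  nsmul := nsmulRec
  mul_assoc a b c := by
    induction a using Quotient.inductionOn
    induction b using Quotient.inductionOn
    induction c using Quotient.inductionOn
    exact mk_eq_mk.2 (tensor_assoc ..)
  one_mul := one_mul' ω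
  mul_one a := by rw [mul_comm', one_mul']
  mul_comm := mul_comm' ω
  zero_mul := zero_mul' ω
  mul_zero a := by rw [mul_comm', zero_mul']
  right_distrib := add_mul' ω
  left_distrib a b c := by rw [mul_comm', add_mul', mul_comm' ω b, mul_comm' ω c]

end IsoClass

/-- The Grothendieck group of the additive monoid of a commutative semiring. -/
def GrothendieckRing (S : Type u) [CommSemiring S] : Type u := Algebra.GrothendieckAddGroup S

namespace GrothendieckRing

variable {S : Type u} [CommSemiring S]

instance : AddCommGroup (GrothendieckRing S) :=
  inferInstanceAs (AddCommGroup (Algebra.GrothendieckAddGroup S))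

/-- The canonical map. -/
def of : S →+ GrothendieckRing S := Algebra.GrothendieckAddGroup.of

/-- The universal property of the Grothendieck group. -/
def lift {G : Type*} [AddCommGroup G] (f : S →+ G) : GrothendieckRing S →+ G :=
  Algebra.GrothendieckAddGroup.lift f

theorem lift_of {G : Type*} [AddCommGroup G] (f : S →+ G) (a : S) : lift f (of a) = f a :=
  DFunLike.congr_fun (Algebra.GrothendieckAddGroup.lift.symm_apply_apply f) a

theorem hom_ext {G : Type*} [AddCommGroup G] {f g : GrothendieckRing S →+ G}
    (h : ∀ a, f (of a) = g (of a)) : f = g :=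
  Algebra.GrothendieckAddGroup.lift.symm.injective (AddMonoidHom.ext h)

/-- The biadditive extension of the multiplication. -/
def mulHom : GrothendieckRing S →+ GrothendieckRing S →+ GrothendieckRing S :=
  lift
    { toFun := fun a ↦ lift (of.comp (AddMonoidHom.mulLeft a))
      map_zero' := hom_ext fun b ↦ by simp [lift_of]
      map_add' := fun a a' ↦ hom_ext fun b ↦ by simp [lift_of, add_mul] }

theorem mulHom_of (a b : S) : mulHom (of a) (of b) = of (a * b) := by
  simp [mulHom, lift_of]

instance : Mul (GrothendieckRing S) := ⟨fun a b ↦ mulHom a b⟩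

instance : One (GrothendieckRing S) := ⟨of 1⟩

theorem mul_def (a b : GrothendieckRing S) : a * b = mulHom a b := rfl

theorem of_mul (a b : S) : of (a * b) = of a * of b := (mulHom_of a b).symm

theorem of_one : of (1 : S) = 1 := rfl

theorem induction {P : GrothendieckRing S → Prop} (of : ∀ a, P (of a))
    (sub : ∀ a b, P a → P b → P (a - b)) (a : GrothendieckRing S) : P a := by
  have key : ∀ x : Algebra.GrothendieckAddGroup S, P x := fun x ↦ by
    induction x using AddLocalization.ind with
    | _ y =>
      obtain ⟨a, b, hb⟩ := y
      have h := sub _ _ (of a) (of b)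
      have e : (AddLocalization.mk a ⟨b, hb⟩ : Algebra.GrothendieckAddGroup S) =
          Algebra.GrothendieckAddGroup.of a - Algebra.GrothendieckAddGroup.of b := by
        change _ = (AddLocalization.mk a 0 : Algebra.GrothendieckAddGroup S) -
          (AddLocalization.mk b 0 : Algebra.GrothendieckAddGroup S)
        rw [Algebra.GrothendieckAddGroup.mk_sub_mk]
        congr 1
        · simp
        · exact Subtype.ext (by simp)
      rw [e]
      exact h
  exact key a

theorem mul_comm' (a b : GrothendieckRing S) : a * b = b * a := by
  rw [mul_def, mul_def]
  induction a using induction with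
  | sub a a' h h' => simp [h, h']
  | of a =>
    induction b using induction with
    | sub b b' h h' => simp [h, h']
    | of b => rw [mulHom_of, mulHom_of, mul_comm]

theorem mul_assoc' (a b c : GrothendieckRing S) : a * b * c = a * (b * c) := by
  simp only [mul_def]
  induction a using induction with
  | sub a a' h h' => simp [h, h']
  | of a =>
    induction b using induction with
    | sub b b' h h' => simp [h, h']
    | of b =>
      induction c using induction with
      | sub c c' h h' => simp [h, h']
      | of c => simp only [mulHom_of, mul_assoc]

theorem one_mul' (a : GrothendieckRing S) : 1 * a = a := by
  rw [mul_def]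
  induction a using induction with
  | sub a a' h h' => simp [h, h']
  | of a => rw [← of_one, mulHom_of, one_mul]

/-- The Grothendieck ring of a commutative semiring. -/
instance : CommRing (GrothendieckRing S) where
  __ := (inferInstance : AddCommGroup (GrothendieckRing S))
  mul_comm := mul_comm'
  mul_assoc := mul_assoc'
  one_mul := one_mul'
  mul_one a := by rw [mul_comm', one_mul']
  zero_mul a := by rw [mul_def, map_zero, AddMonoidHom.zero_apply]
  mul_zero a := by rw [mul_def, map_zero]
  left_distrib a b c := by rw [mul_def, map_add]; rfl
  right_distrib a b c := by rw [mul_def, map_add]; rfl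

end GrothendieckRing

/-- The complexified split Grothendieck ring `ℂ ⊗ K₀` of the weight modules over `A(R, σ, 1)` with
support in `ω`. -/
abbrev SplitGrothendieckRing {R : Type u} [CommRing R] {σ : RingAut R} (ω : FiniteOrbit σ) :
    Type (u + 1) :=
  ℂ ⊗[ℤ] GrothendieckRing (IsoClass ω)

/-- The class of a module in the split Grothendieck ring. -/
def splitClass {R : Type u} [CommRing R] {σ : RingAut R} {ω : FiniteOrbit σ}
    (M : WeightModule σ 1 ω.carrier) : SplitGrothendieckRing ω :=
  1 ⊗ₜ GrothendieckRing.of (IsoClass.mk M)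


/-! ### The algebra `ℂ[z, z⁻¹]` and the orbit of `z - 1` -/

namespace SkewLaurent

open LaurentPolynomial

theorem laurent_hom_ext {S : Type*} [CommRing S] {f g : ℂ[T;T⁻¹] →+* S}
    (hC : ∀ a, f (C a) = g (C a)) (hT : f (T 1) = g (T 1)) : f = g := by
  have hu : Units.map f.toMonoidHom (isUnit_T (R := ℂ) 1).unit =
      Units.map g.toMonoidHom (isUnit_T (R := ℂ) 1).unit := Units.ext hT
  have hv (n : ℤ) : (((isUnit_T (R := ℂ) 1).unit ^ n : ℂ[T;T⁻¹]ˣ) : ℂ[T;T⁻¹]) = T n := by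
    induction n with
    | zero => simp
    | succ n ih => rw [zpow_add_one, Units.val_mul, ih, T_add, IsUnit.unit_spec]
    | pred n ih =>
      rw [zpow_sub_one, Units.val_mul, ih, Units.mul_inv_eq_iff_eq_mul, IsUnit.unit_spec, ← T_add,
        sub_add_cancel]
  refine RingHom.ext fun x ↦ ?_
  induction x using LaurentPolynomial.induction_on' with
  | add x y hx hy => rw [map_add, map_add, hx, hy]
  | C_mul_T n a =>
    rw [map_mul, map_mul, hC, ← hv]
    have := congrArg (fun u : Sˣ ↦ ((u ^ n : Sˣ) : S)) hu
    rw [← map_zpow, ← map_zpow] at this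
    exact congrArg _ this

/-- Evaluation of Laurent polynomials at `c`. -/
def evalAt (c : ℂˣ) : ℂ[T;T⁻¹] →+* ℂ := eval₂ (RingHom.id ℂ) c

@[simp] theorem evalAt_C (c : ℂˣ) (a : ℂ) : evalAt c (C a) = a := by simp [evalAt]

@[simp] theorem evalAt_T (c : ℂˣ) : evalAt c (T 1) = c := by simp [evalAt]

/-- The ring homomorphism over `ℂ` that sends `z` to `c z`. -/
def scaleHom (c : ℂˣ) : ℂ[T;T⁻¹] →+* ℂ[T;T⁻¹] :=
  eval₂ C (Units.map (C : ℂ →+* ℂ[T;T⁻¹]).toMonoidHom c * (isUnit_T 1).unit)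

@[simp] theorem scaleHom_C (c : ℂˣ) (a : ℂ) : scaleHom c (C a) = C a := by simp [scaleHom]

@[simp] theorem scaleHom_T (c : ℂˣ) : scaleHom c (T 1) = C (c : ℂ) * T 1 := by simp [scaleHom]

theorem scaleHom_comp (c d : ℂˣ) : (scaleHom c).comp (scaleHom d) = scaleHom (c * d) :=
  laurent_hom_ext (fun a ↦ by simp) (by simp; ring)

theorem scaleHom_one : scaleHom 1 = RingHom.id _ :=
  laurent_hom_ext (fun a ↦ by simp) (by simp)

/-- The automorphism of `ℂ[z, z⁻¹]` over `ℂ` that sends `z` to `c z`. -/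
def scale (c : ℂˣ) : RingAut ℂ[T;T⁻¹] :=
  RingEquiv.ofRingHom (scaleHom c) (scaleHom c⁻¹)
    (by rw [scaleHom_comp, mul_inv_cancel, scaleHom_one])
    (by rw [scaleHom_comp, inv_mul_cancel, scaleHom_one])

theorem scale_apply (c : ℂˣ) (f : ℂ[T;T⁻¹]) : scale c f = scaleHom c f := rfl

theorem scale_C (c : ℂˣ) (a : ℂ) : scale c (C a) = C a := scaleHom_C c a

theorem scale_T (c : ℂˣ) : scale c (T 1) = C (c : ℂ) * T 1 := scaleHom_T c

theorem scale_mul (c d : ℂˣ) : scale (c * d) = scale c * scale d :=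
  RingEquiv.ext fun f ↦ (DFunLike.congr_fun (scaleHom_comp c d) f).symm

theorem scale_zpow (c : ℂˣ) (i : ℤ) : scale c ^ i = scale (c ^ i) :=
  (map_zpow (MonoidHom.mk' scale scale_mul) c i).symm

theorem scale_symm (c : ℂˣ) : (scale c).symm = scale c⁻¹ :=
  (map_inv (MonoidHom.mk' scale scale_mul) c).symm

theorem evalAt_scale (c d : ℂˣ) (f : ℂ[T;T⁻¹]) : evalAt c (scale d f) = evalAt (c * d) f := by
  refine DFunLike.congr_fun (f := (evalAt c).comp (scaleHom d)) (g := evalAt (c * d)) ?_ f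
  exact laurent_hom_ext (fun a ↦ by simp) (by simp; ring)

/-- The ideal generated by `z - c`. -/
def pointIdeal (c : ℂˣ) : Ideal ℂ[T;T⁻¹] := Ideal.span {T 1 - C (c : ℂ)}

theorem mem_pointIdeal (c : ℂˣ) (f : ℂ[T;T⁻¹]) : f ∈ pointIdeal c ↔ evalAt c f = 0 := by
  have h : (Ideal.Quotient.mk (pointIdeal c)) =
      ((Ideal.Quotient.mk (pointIdeal c)).comp C).comp (evalAt c) := by
    refine laurent_hom_ext (fun a ↦ by simp) ?_
    simp only [RingHom.comp_apply, evalAt_T]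
    exact (Ideal.Quotient.mk_eq_mk_iff_sub_mem _ _).2 (Ideal.subset_span rfl)
  refine ⟨fun hf ↦ ?_, fun hf ↦ ?_⟩
  · have : pointIdeal c ≤ RingHom.ker (evalAt c) :=
      Ideal.span_le.2 (Set.singleton_subset_iff.2 (by simp [RingHom.mem_ker]))
    exact this hf
  · rw [← Ideal.Quotient.eq_zero_iff_mem, h]
    simp [hf]

theorem pointIdeal_isMaximal (c : ℂˣ) : (pointIdeal c).IsMaximal := by
  have h : pointIdeal c = RingHom.ker (evalAt c) := Ideal.ext fun f ↦ mem_pointIdeal c f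
  rw [h]
  exact RingHom.ker_isMaximal_of_surjective _ fun a ↦ ⟨C a, evalAt_C c a⟩

theorem map_scale_pointIdeal (c d : ℂˣ) :
    (pointIdeal c).map (scale d) = pointIdeal (c * d⁻¹) := by
  ext f
  rw [Ideal.mem_map_of_equiv, mem_pointIdeal]
  constructor
  · rintro ⟨g, hg, rfl⟩
    rw [evalAt_scale, inv_mul_cancel_right]
    exact (mem_pointIdeal c g).1 hg
  · refine fun h ↦ ⟨scale d⁻¹ f, ?_, ?_⟩
    · rwa [mem_pointIdeal, evalAt_scale]
    · rw [← RingAut.mul_apply, ← scale_mul, mul_inv_cancel, scale_apply, scaleHom_one]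
      rfl

/-- The maximal ideal generated by `z - c`. -/
def point (c : ℂˣ) : MaximalSpectrum ℂ[T;T⁻¹] := ⟨pointIdeal c, pointIdeal_isMaximal c⟩

/-- The primitive root of unity `q = exp(2πi/p)`. -/
def rootQ (p : ℕ) : ℂˣ :=
  Units.mk0 (Complex.exp (2 * Real.pi * Complex.I / p)) (Complex.exp_ne_zero _)

theorem rootQ_pow (p : ℕ) [NeZero p] : rootQ p ^ p = 1 :=
  Units.ext (Complex.isPrimitiveRoot_exp p (NeZero.ne p)).pow_eq_one

/-- The automorphism `σ` of `ℂ[z, z⁻¹]` with `σ(z) = q⁻¹ z`. -/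
def sigma (p : ℕ) : RingAut ℂ[T;T⁻¹] := scale (rootQ p)⁻¹

theorem map_sigma_zpow (p : ℕ) (i : ℤ) :
    (pointIdeal 1).map (sigma p ^ i : RingAut ℂ[T;T⁻¹]) = pointIdeal (rootQ p ^ i) := by
  rw [sigma, scale_zpow, map_scale_pointIdeal, inv_zpow, inv_inv, one_mul]

theorem rootQ_zpow_eq (p : ℕ) [NeZero p] (i : ℤ) :
    ∃ k : Fin p, rootQ p ^ i = rootQ p ^ (k : ℕ) := by
  have hp : (0 : ℤ) < p := by exact_mod_cast Nat.pos_of_ne_zero (NeZero.ne p)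
  have h0 := Int.emod_nonneg i hp.ne'
  have h1 := Int.emod_lt_of_pos i hp
  refine ⟨⟨(i % p).toNat, by omega⟩, ?_⟩
  conv_lhs => rw [← Int.emod_add_mul_ediv i p, zpow_add, zpow_mul, zpow_natCast, rootQ_pow,
    one_zpow, mul_one]
  rw [← zpow_natCast, Int.toNat_of_nonneg h0]

/-- The orbit `ω` of the maximal ideal generated by `z - 1`. -/
def orbit (p : ℕ) [NeZero p] : FiniteOrbit (sigma p) where
  carrier := {m | ∃ i : ℤ, m.asIdeal = (point 1).asIdeal.map (sigma p ^ i : RingAut ℂ[T;T⁻¹])}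
  base := point 1
  mem_iff _ := Iff.rfl
  finite := by
    refine (Set.finite_range fun k : Fin p ↦ point (rootQ p ^ (k : ℕ))).subset ?_
    rintro m ⟨i, hi⟩
    obtain ⟨k, hk⟩ := rootQ_zpow_eq p i
    refine ⟨k, MaximalSpectrum.ext ?_⟩
    rw [hi]
    refine Eq.trans ?_ (map_sigma_zpow p i).symm
    rw [hk]
    rfl

/-- The orbit consists of the ideals generated by `z - q ^ k`. -/
theorem mem_orbit_iff (p : ℕ) [NeZero p] (m : MaximalSpectrum ℂ[T;T⁻¹]) :
    m ∈ (orbit p).carrier ↔ ∃ k : ℕ, k < p ∧ m = point (rootQ p ^ k) := by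
  constructor
  · rintro ⟨i, hi⟩
    obtain ⟨k, hk⟩ := rootQ_zpow_eq p i
    refine ⟨k, k.2, MaximalSpectrum.ext ?_⟩
    rw [hi, ← hk]
    exact map_sigma_zpow p i
  · rintro ⟨k, -, rfl⟩
    refine ⟨k, ?_⟩
    refine Eq.trans ?_ (map_sigma_zpow p k).symm
    rw [zpow_natCast]
    rfl

theorem point_mem_orbit (p : ℕ) [NeZero p] (k : ℕ) :
    point (rootQ p ^ k) ∈ (orbit p).carrier := by
  obtain ⟨j, hj⟩ := rootQ_zpow_eq p k
  rw [zpow_natCast] at hj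
  exact (mem_orbit_iff p _).2 ⟨j, j.2, by rw [hj]⟩

/-! ### The modules attached to invertible matrices -/

/-- The weight of the `k`-th summand, where `k = 0, …, p - 1` stands for the index `k + 1` in
`1, …, p`. -/
def weight (p : ℕ) (k : Fin p) : ℂˣ := rootQ p ^ ((k : ℕ) + 1)

theorem weight_add_one (p : ℕ) [NeZero p] (k : Fin p) :
    weight p (k + 1) = weight p k * rootQ p := by
  rw [weight, weight, ← pow_succ, Fin.val_add, pow_succ, pow_succ, pow_succ]
  congr 1
  rw [← pow_succ, Fin.val_one']
  have h : ((k : ℕ) + 1 % p) % p = (k + 1) % p := by simp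
  rw [h]
  conv_rhs => rw [← Nat.mod_add_div ((k : ℕ) + 1) p, pow_add, pow_mul, rootQ_pow, one_pow, mul_one]

/-- The space `⨁ₖ (R ⧸ (z - q ^ k)) ^ d` for `k = 1, …, p`, where `R ⧸ (z - c)` is identified
with `ℂ` by evaluation at `c`. -/
def CircleSpace (p d : ℕ) : Type := Fin p → Fin d → ℂ

namespace CircleSpace

variable (p d : ℕ)

instance : AddCommGroup (CircleSpace p d) := inferInstanceAs (AddCommGroup (Fin p → Fin d → ℂ))

instance : Module ℂ (CircleSpace p d) := inferInstanceAs (Module ℂ (Fin p → Fin d → ℂ))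

instance : Module.Finite ℂ (CircleSpace p d) :=
  inferInstanceAs (Module.Finite ℂ (Fin p → Fin d → ℂ))

/-- A Laurent polynomial acts on the `k`-th summand by its value at `q ^ (k + 1)`. -/
instance : Module ℂ[T;T⁻¹] (CircleSpace p d) where
  smul f v := fun k ↦ evalAt (weight p k) f • v k
  one_smul v := funext fun k ↦ by change evalAt _ 1 • v k = v k; rw [map_one, one_smul]
  mul_smul f g v := funext fun k ↦ by
    change evalAt _ (f * g) • v k = evalAt _ f • evalAt _ g • v k
    rw [map_mul, mul_smul]
  smul_zero f := funext fun k ↦ smul_zero (evalAt (weight p k) f)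
  smul_add f v w := funext fun k ↦ smul_add (evalAt (weight p k) f) (v k) (w k)
  add_smul f g v := funext fun k ↦ by
    change evalAt _ (f + g) • v k = evalAt _ f • v k + evalAt _ g • v k
    rw [map_add, add_smul]
  zero_smul v := funext fun k ↦ by change evalAt _ 0 • v k = 0; rw [map_zero, zero_smul]

variable {p d}

theorem smul_apply (f : ℂ[T;T⁻¹]) (v : CircleSpace p d) (k : Fin p) :
    (f • v) k = evalAt (weight p k) f • v k := rfl

theorem add_apply (v w : CircleSpace p d) (k : Fin p) : (v + w) k = v k + w k := rfl

instance : IsScalarTower ℂ ℂ[T;T⁻¹] (CircleSpace p d) where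
  smul_assoc a f v := funext fun k ↦ by
    change evalAt _ (a • f) • v k = a • evalAt _ f • v k
    rw [smul_eq_C_mul, map_mul, evalAt_C, mul_smul]

theorem isWeight [NeZero p] : IsWeight (orbit p).carrier (CircleSpace p d) := by
  have : Module.Finite ℂ[T;T⁻¹] (CircleSpace p d) :=
    Module.Finite.of_restrictScalars_finite ℂ ℂ[T;T⁻¹] _
  refine isWeight_of (orbit p).finite fun f hf v ↦ funext fun k ↦ ?_
  rw [smul_apply, weight, (mem_pointIdeal _ _).1 (mem_idealOf.1 hf _ (point_mem_orbit p (k + 1))),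
    zero_smul]
  rfl

variable [NeZero p]

open Matrix in
/-- The action of `X`: the basis vector `e_{k, s}` is sent to `e_{k+1, s}` if `k ≠ p`, and `e_{p, s}`
to `F e_{1, s}`. -/
def actX (F : GL (Fin d) ℂ) : CircleSpace p d →+ CircleSpace p d :=
  AddMonoidHom.mk' (fun v k ↦ if k = 0 then (F : Matrix (Fin d) (Fin d) ℂ) *ᵥ v (k - 1)
    else v (k - 1)) fun v w ↦ funext fun k ↦ by
      change (if k = 0 then F.1 *ᵥ (v (k - 1) + w (k - 1)) else v (k - 1) + w (k - 1)) =
        (if k = 0 then F.1 *ᵥ v (k - 1) else v (k - 1)) + (if k = 0 then F.1 *ᵥ w (k - 1) else w (k - 1))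
      split_ifs
      · rw [mulVec_add]
      · rfl

open Matrix in
/-- The action of `Y`: the basis vector `e_{k, s}` is sent to `e_{k-1, s}` if `k ≠ 1`, and `e_{1, s}`
to `F⁻¹ e_{p, s}`. -/
def actY (F : GL (Fin d) ℂ) : CircleSpace p d →+ CircleSpace p d :=
  AddMonoidHom.mk' (fun v k ↦ if k + 1 = 0
    then ((F⁻¹ : GL (Fin d) ℂ) : Matrix (Fin d) (Fin d) ℂ) *ᵥ v (k + 1)
    else v (k + 1)) fun v w ↦ funext fun k ↦ by
      change (if k + 1 = 0 then F⁻¹.1 *ᵥ (v (k + 1) + w (k + 1)) else v (k + 1) + w (k + 1)) =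
        (if k + 1 = 0 then F⁻¹.1 *ᵥ v (k + 1) else v (k + 1)) + (if k + 1 = 0 then F⁻¹.1 *ᵥ w (k + 1) else w (k + 1))
      split_ifs
      · rw [mulVec_add]
      · rfl

open Matrix in
theorem actX_apply (F : GL (Fin d) ℂ) (v : CircleSpace p d) (k : Fin p) :
    actX F v k = if k = 0 then (F : Matrix (Fin d) (Fin d) ℂ) *ᵥ v (k - 1) else v (k - 1) := rfl

open Matrix in
theorem actY_apply (F : GL (Fin d) ℂ) (v : CircleSpace p d) (k : Fin p) :
    actY F v k = if k + 1 = 0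
      then ((F⁻¹ : GL (Fin d) ℂ) : Matrix (Fin d) (Fin d) ℂ) *ᵥ v (k + 1) else v (k + 1) := rfl

end CircleSpace

/-- The module `V(ω, 1^p, F)` over `A(R, σ, 1)` for an invertible matrix `F`. -/
def circleModule (p : ℕ) [NeZero p] {d : ℕ} (F : GL (Fin d) ℂ) :
    WeightModule (sigma p) 1 (orbit p).carrier :=
  .of (CircleSpace p d) (CircleSpace.actX F) (CircleSpace.actY F)
    (fun f v ↦ funext fun k ↦ by
      obtain ⟨k, rfl⟩ : ∃ j : Fin p, k = j + 1 := ⟨k - 1, (sub_add_cancel _ _).symm⟩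
      have h : evalAt (weight p (k + 1)) (sigma p f) = evalAt (weight p k) f := by
        rw [sigma, evalAt_scale, weight_add_one, mul_inv_cancel_right]
      rw [CircleSpace.smul_apply, CircleSpace.actX_apply, CircleSpace.actX_apply, h,
        add_sub_cancel_right, CircleSpace.smul_apply]
      split_ifs
      · rw [Matrix.mulVec_smul]
      · rfl)
    (fun f v ↦ funext fun k ↦ by
      have h : evalAt (weight p k) ((sigma p).symm f) = evalAt (weight p (k + 1)) f := by
        rw [sigma, scale_symm, inv_inv, evalAt_scale, weight_add_one]
      rw [CircleSpace.smul_apply, CircleSpace.actY_apply, CircleSpace.actY_apply, h,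
        CircleSpace.smul_apply]
      split_ifs
      · rw [Matrix.mulVec_smul]
      · rfl)
    (fun v ↦ funext fun k ↦ by
      rw [one_smul, CircleSpace.actY_apply, CircleSpace.actX_apply, add_sub_cancel_right]
      split_ifs
      · rw [Matrix.mulVec_mulVec, ← Units.val_mul, inv_mul_cancel, Units.val_one, Matrix.one_mulVec]
      · rfl)
    (fun v ↦ funext fun k ↦ by
      rw [map_one, one_smul, CircleSpace.actX_apply, CircleSpace.actY_apply, sub_add_cancel]
      split_ifs
      · rw [Matrix.mulVec_mulVec, ← Units.val_mul, mul_inv_cancel, Units.val_one, Matrix.one_mulVec]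
      · rfl)
    CircleSpace.isWeight

/-- The companion matrix of a polynomial of degree `d`: its last column has the entries
`-αᵢ / α_d`, and the entries below the diagonal are `1`. -/
def companion (f : Polynomial ℂ) : Matrix (Fin f.natDegree) (Fin f.natDegree) ℂ :=
  .of fun i j ↦ if (j : ℕ) + 1 = f.natDegree then -f.coeff i / f.leadingCoeff
    else if (i : ℕ) = j + 1 then 1 else 0

theorem companion_isUnit {f : Polynomial ℂ} (hf : f.coeff 0 ≠ 0) : IsUnit (companion f) := by
  rw [← Matrix.mulVec_injective_iff_isUnit, ← Matrix.coe_mulVecLin, ← LinearMap.ker_eq_bot,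
    LinearMap.ker_eq_bot']
  intro v hv
  have hlc : f.leadingCoeff ≠ 0 :=
    Polynomial.leadingCoeff_ne_zero.2 fun h ↦ hf (by simp [h])
  have h : ∀ i, ∑ j, companion f i j * v j = 0 := fun i ↦ congrFun hv i
  by_cases hd : f.natDegree = 0
  · exact funext fun i ↦ absurd i.2 (by omega)
  have hlast : v ⟨f.natDegree - 1, by omega⟩ = 0 := by
    have h0 := h ⟨0, by omega⟩
    rw [Finset.sum_eq_single ⟨f.natDegree - 1, by omega⟩] at h0
    · have e : f.natDegree - 1 + 1 = f.natDegree := by omega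
      simpa [companion, e, hf, hlc] using h0
    · intro j _ hj
      have e : (j : ℕ) + 1 ≠ f.natDegree := fun e ↦ hj (Fin.ext (by simp; omega))
      simp [companion, e]
    · simp
  funext k
  by_cases hk : (k : ℕ) + 1 = f.natDegree
  · have e : k = ⟨f.natDegree - 1, by omega⟩ := Fin.ext (by simp; omega)
    rw [e]; exact hlast
  · have hk' : (k : ℕ) + 1 < f.natDegree := by have := k.2; omega
    have h0 := h ⟨k + 1, hk'⟩
    rw [Finset.sum_eq_single k] at h0
    · simpa [companion, hk] using h0
    · intro j _ hj
      by_cases e : (j : ℕ) + 1 = f.natDegree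
      · have e' : j = ⟨f.natDegree - 1, by omega⟩ := Fin.ext (by simp; omega)
        rw [e', hlast, mul_zero]
      · have e' : (k : ℕ) ≠ j := fun e' ↦ hj (Fin.ext e'.symm)
        simp [companion, e, e']
    · simp

theorem coeff_zero_ne (ξ : ℂˣ) (a : ℕ) :
    ((Polynomial.X - Polynomial.C (ξ : ℂ)) ^ a).coeff 0 ≠ 0 := by
  simp [Polynomial.coeff_zero_eq_eval_zero]

/-- The class `u(ξ, a)` of the module `V(ω, 1^p, F)`, where `F` is the companion matrix of
`(x - ξ) ^ a`. -/
def u (p : ℕ) [NeZero p] (ξ : ℂˣ) (a : ℕ) : SplitGrothendieckRing (orbit p) :=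
  splitClass (circleModule p (companion_isUnit (coeff_zero_ne ξ a)).unit)

end SkewLaurent

end

/-!
Since `q ^ p = 1`, the element `X ^ p` is central, so it acts on the weight space `M₁` at the point
`1`, and `M = ⨁ⱼ X⁻ʲ M₁` is determined by the vector space `M₁` with this automorphism, its
monodromy. Direct sums and tensor products over `ℂ[z, z⁻¹]` go to direct sums and tensor products
over `ℂ`, so the ring is the Grothendieck ring of finite dimensional vector spaces with an
automorphism and is spanned by the Jordan blocks `J_a(ξ)`.

The endomorphism `J_2(1) ⊗ J_{n+1}(ξ) - ξ` is nilpotent of index exactly `n + 2`, so this tensor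
product is a sum of blocks with eigenvalue `ξ` of size at most `n + 2`, in which that size occurs.
Hence `J_1(ξ) ⊗ J_2(1)^n` is a nonzero multiple of `J_{n+1}(ξ)` plus smaller blocks with eigenvalue
`ξ`, which gives generation. Counting the blocks of each size, by the ranks of `(F - ξ) ^ n`, reads
off the leading coefficient of a polynomial in `J_2(1)`, which gives injectivity.
-/

noncomputable section

open Polynomial TensorProduct

/-! ### Ranks of polynomials in an endomorphism -/

theorem aeval_semiconj {R V V' : Type*} [CommSemiring R] [AddCommMonoid V] [Module R V]
    [AddCommMonoid V'] [Module R V'] {F : Module.End R V} {F' : Module.End R V'} (e : V →ₗ[R] V')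
    (h : Function.Semiconj e F F') (g : R[X]) :
    Function.Semiconj e (aeval F g) (aeval F' g) := by
  induction g using Polynomial.induction_on' with
  | add g g' hg hg' =>
    intro v
    simp only [map_add, LinearMap.add_apply, hg v, hg' v]
  | monomial n a =>
    intro v
    simp only [aeval_monomial, Module.End.mul_apply, Module.algebraMap_end_apply, map_smul,
      Module.End.coe_pow, (h.iterate_right n).eq v]

section PolyRank

variable {K V V' : Type*} [Field K] [AddCommGroup V] [Module K V] [AddCommGroup V'] [Module K V']

/-- The rank of the endomorphism `g(F)`. For `g = (X - c) ^ n` these ranks determine the sizes of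
the Jordan blocks of `F` with eigenvalue `c`. -/
def polyRank (F : Module.End K V) (g : K[X]) : ℕ :=
  Module.finrank K (LinearMap.range (aeval F g))

theorem polyRank_congr {F : Module.End K V} {F' : Module.End K V'} (e : V ≃ₗ[K] V')
    (h : Function.Semiconj e F F') (g : K[X]) : polyRank F g = polyRank F' g := by
  have he : (aeval F' g) ∘ₗ e.toLinearMap = e.toLinearMap ∘ₗ aeval F g :=
    LinearMap.ext fun v ↦ (aeval_semiconj e.toLinearMap h g v).symm
  rw [polyRank, polyRank, ← LinearEquiv.range_comp e (aeval F' g), he, LinearMap.range_comp]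
  exact (LinearEquiv.finrank_map_eq e _).symm

theorem polyRank_prodMap [Module.Finite K V] [Module.Finite K V'] (F : Module.End K V)
    (F' : Module.End K V') (g : K[X]) :
    polyRank (F.prodMap F') g = polyRank F g + polyRank F' g := by
  have h : aeval (F.prodMap F') g = (aeval F g).prodMap (aeval F' g) :=
    LinearMap.ext fun v ↦ Prod.ext
      (aeval_semiconj (F := F.prodMap F') (LinearMap.fst K V V') (fun _ ↦ rfl) g v)
      (aeval_semiconj (F := F.prodMap F') (LinearMap.snd K V V') (fun _ ↦ rfl) g v)
  rw [polyRank, polyRank, polyRank, h, LinearMap.range_prodMap, ← Module.finrank_prod]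
  exact LinearEquiv.finrank_eq
    { Equiv.Set.prod _ _ with
      map_add' := fun _ _ ↦ rfl
      map_smul' := fun _ _ ↦ rfl }

theorem polyRank_eq_zero_iff [Module.Finite K V] (F : Module.End K V) (g : K[X]) :
    polyRank F g = 0 ↔ aeval F g = 0 := by
  rw [polyRank, Submodule.finrank_eq_zero, LinearMap.range_eq_bot]

end PolyRank

/-! ### Jordan blocks as quotients of the polynomial ring -/

theorem aeval_lmul {R A : Type*} [CommSemiring R] [Semiring A] [Algebra R A] (a : A) (g : R[X]) :
    aeval (Algebra.lmul R A a) g = Algebra.lmul R A (aeval a g) :=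
  aeval_algHom_apply (Algebra.lmul R A) a g

/-- Multiplication by the root on `R[X] / (f)`; for `f = (X - c) ^ a` this is the Jordan block of
size `a` with eigenvalue `c`. -/
def mulRoot {R : Type*} [CommRing R] (f : R[X]) : Module.End R (AdjoinRoot f) :=
  Algebra.lmul R (AdjoinRoot f) (AdjoinRoot.root f)

theorem aeval_mulRoot {R : Type*} [CommRing R] (f g : R[X]) :
    aeval (mulRoot f) g = Algebra.lmul R (AdjoinRoot f) (AdjoinRoot.mk f g) := by
  rw [mulRoot, aeval_lmul, AdjoinRoot.aeval_eq]

theorem aeval_mulRoot_eq_zero_iff {R : Type*} [CommRing R] (f g : R[X]) :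
    aeval (mulRoot f) g = 0 ↔ f ∣ g := by
  rw [aeval_mulRoot, map_eq_zero_iff _ Algebra.lmul_injective, AdjoinRoot.mk_eq_zero]

theorem polyRank_mulRoot_of_isCoprime {K : Type*} [Field K] {f g : K[X]} (h : IsCoprime g f) :
    polyRank (mulRoot f) g = Module.finrank K (AdjoinRoot f) := by
  obtain ⟨a, b, hab⟩ := h
  have hinv : AdjoinRoot.mk f g * AdjoinRoot.mk f a = 1 := by
    rw [← map_mul, ← map_one (AdjoinRoot.mk f), AdjoinRoot.mk_eq_mk]
    exact ⟨-b, by linear_combination hab⟩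
  have hrange : LinearMap.range (aeval (mulRoot f) g) = ⊤ := by
    rw [aeval_mulRoot, LinearMap.range_eq_top]
    exact fun x ↦ ⟨AdjoinRoot.mk f a * x,
      (mul_assoc _ _ x).symm.trans (by rw [hinv, one_mul])⟩
  rw [polyRank, hrange, finrank_top]

theorem equivFun_symm_semiconj_leftMulMatrix {R S ι : Type*} [CommRing R] [Ring S] [Algebra R S]
    [Fintype ι] [DecidableEq ι] (b : Module.Basis ι R S) (x : S) :
    Function.Semiconj b.equivFun.symm (Matrix.toLin' (Algebra.leftMulMatrix b x)) (x * ·) := by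
  intro w
  have h := Algebra.leftMulMatrix_mulVec_repr b x (b.equivFun.symm w)
  rwa [← Module.Basis.equivFun_apply, ← Module.Basis.equivFun_apply,
    LinearEquiv.apply_symm_apply, ← LinearEquiv.symm_apply_eq] at h

theorem exists_mulRoot_X_sub_C_equiv {R : Type*} [CommRing R] (c : R) :
    ∃ e : AdjoinRoot (X - C c) ≃ₗ[R] R, Function.Semiconj e (mulRoot (X - C c)) (c * ·) := by
  let e := quotientSpanXSubCAlgEquiv c
  refine ⟨e.toLinearEquiv, fun x ↦ (map_mul e (Ideal.Quotient.mk _ X) x).trans ?_⟩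
  rw [quotientSpanXSubCAlgEquiv_mk, eval_X]
  rfl

theorem eq_of_X_sub_C_pow_dvd_X_sub_C_pow {K : Type*} [Field K] {c d : K} {a b : ℕ} (ha : a ≠ 0)
    (h : (X - C c) ^ a ∣ (X - C d) ^ b) : c = d ∧ a ≤ b := by
  have hcd : c = d := by
    have hroot : (X - C c) ∣ X - C d :=
      (prime_X_sub_C c).dvd_of_dvd_pow ((dvd_pow_self _ ha).trans h)
    rwa [dvd_iff_isRoot, IsRoot.def, eval_sub, eval_X, eval_C, sub_eq_zero] at hroot
  subst hcd
  exact ⟨rfl, (pow_dvd_pow_iff (X_sub_C_ne_zero c) (not_isUnit_X_sub_C c)).1 h⟩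

section Jordan

variable {K V : Type*} [Field K] [AddCommGroup V] [Module K V]

theorem exists_semiconj_mulRoot_piMap [IsAlgClosed K] [Module.Finite K V] (F : Module.End K V) :
    ∃ (n : ℕ) (c : Fin n → K) (a : Fin n → ℕ) (e : V ≃ₗ[K] ∀ i, AdjoinRoot ((X - C (c i)) ^ a i)),
      Function.Semiconj e F (LinearMap.piMap fun i ↦ mulRoot ((X - C (c i)) ^ a i)) := by
  obtain ⟨ι, _, q, hq, a, ⟨φ⟩⟩ := Module.equiv_directSum_of_isTorsion
    (Module.AEval.isTorsion_of_finiteDimensional K V F)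
  have hlinear (i : ι) : ∃ c, Associated (q i) (X - C c) := by
    obtain ⟨c, hc⟩ := IsAlgClosed.exists_root (q i) (hq i).degree_pos.ne'
    exact ⟨c, ((irreducible_X_sub_C c).associated_of_dvd (hq i) (dvd_iff_isRoot.2 hc)).symm⟩
  choose c hc using hlinear
  classical
  let r := (Fintype.equivFin ι).symm
  let ψ : Module.AEval' F ≃ₗ[K[X]] ∀ j, K[X] ⧸ Ideal.span {(X - C (c (r j))) ^ a (r j)} :=
    φ ≪≫ₗ DirectSum.linearEquivFunOnFintype K[X] ι _ ≪≫ₗ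
      LinearEquiv.piCongrLeft' K[X] _ (Fintype.equivFin ι) ≪≫ₗ
      LinearEquiv.piCongrRight fun j ↦ Submodule.quotEquivOfEq _ _
        (Ideal.span_singleton_eq_span_singleton.2 (hc (r j)).pow_pow)
  refine ⟨Fintype.card ι, c ∘ r, a ∘ r, (Module.AEval'.of F).trans (ψ.restrictScalars K),
    fun v ↦ funext fun j ↦ ?_⟩
  have hX : ψ (Module.AEval'.of F (F v)) = (X : K[X]) • ψ (Module.AEval'.of F v) := by
    rw [← Module.AEval'.X_smul_of, map_smul]
  exact (congrFun hX j).trans (Algebra.smul_def (X : K[X]) (ψ (Module.AEval'.of F v) j))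

theorem exists_units_X_sub_C_pow_eq {c : K} {a : ℕ}
    (h : Function.Injective (mulRoot ((X - C c) ^ a))) :
    ∃ ξ : Kˣ, (X - C c) ^ a = (X - C (ξ : K)) ^ a := by
  rcases eq_or_ne c 0 with rfl | hc
  · have hpow : aeval (mulRoot ((X - C (0 : K)) ^ a)) (X ^ a) = 0 :=
      (aeval_mulRoot_eq_zero_iff _ _).2 (by rw [C_0, sub_zero])
    rw [aeval_X_pow] at hpow
    have hone : AdjoinRoot.mk ((X - C (0 : K)) ^ a) 1 = 0 :=
      h.iterate a (by rw [← Module.End.coe_pow, hpow]; rfl)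
    rw [AdjoinRoot.mk_eq_zero, ← isUnit_iff_dvd_one, C_0, sub_zero] at hone
    have ha : a = 0 := by_contra fun ha ↦ not_isUnit_X ((isUnit_pow_iff ha).1 hone)
    exact ⟨1, by rw [ha, pow_zero, pow_zero]⟩
  · exact ⟨Units.mk0 c hc, rfl⟩

end Jordan

/-! ### The tensor product with a Jordan block of size two -/

section TensorUnipotent

variable {K A B : Type*} [Field K] [CommRing A] [Algebra K A] [CommRing B] [Algebra K B]
  {x : A} {y : B} {c : K}

theorem tmul_ne_zero {V W : Type*} [AddCommGroup V] [Module K V] [AddCommGroup W] [Module K W]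
    {v : V} {w : W} (hv : v ≠ 0) (hw : w ≠ 0) : v ⊗ₜ[K] w ≠ 0 :=
  ((LinearIndependent.of_subsingleton (v := fun _ ↦ v) () hv).tmul_of_isDomain
    (LinearIndependent.of_subsingleton (v := fun _ ↦ w) () hw)).ne_zero ((), ())

theorem tmul_sub_algebraMap_pow (hx : (x - 1) ^ 2 = 0) (m : ℕ) :
    (x ⊗ₜ[K] y - algebraMap K (A ⊗[K] B) c) ^ (m + 1) =
      1 ⊗ₜ[K] ((y - algebraMap K B c) ^ (m + 1)) +
        ((m : K) + 1) • (x - 1) ⊗ₜ[K] (y * (y - algebraMap K B c) ^ m) := by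
  have hsplit : x ⊗ₜ[K] y - algebraMap K (A ⊗[K] B) c =
      1 ⊗ₜ (y - algebraMap K B c) + (x - 1) ⊗ₜ y := by
    rw [TensorProduct.sub_tmul, TensorProduct.tmul_sub, Algebra.TensorProduct.algebraMap_apply,
      Algebra.algebraMap_eq_smul_one, TensorProduct.smul_tmul, ← Algebra.algebraMap_eq_smul_one]
    abel
  have hsq : ((x - 1) ⊗ₜ[K] y) ^ 2 = 0 := by
    rw [Algebra.TensorProduct.tmul_pow, hx, TensorProduct.zero_tmul]
  have h := aeval_add_of_sq_eq_zero (X ^ (m + 1) : K[X]) (1 ⊗ₜ[K] (y - algebraMap K B c)) _ hsq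
  rw [derivative_X_pow] at h
  simp only [map_mul, aeval_X_pow, aeval_C, Algebra.TensorProduct.tmul_pow, one_pow] at h
  rw [hsplit, h, mul_assoc, add_tsub_cancel_right, Algebra.TensorProduct.tmul_mul_tmul, one_mul,
    ← Algebra.smul_def, mul_comm y]
  push_cast
  rfl

theorem tmul_sub_algebraMap_pow_eq_zero_iff [CharZero K] (hx : ∀ m, (x - 1) ^ m = 0 ↔ 2 ≤ m)
    {n : ℕ} (hy : ∀ m, (y - algebraMap K B c) ^ m = 0 ↔ n + 1 ≤ m) (hc : c ≠ 0) (m : ℕ) :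
    (x ⊗ₜ[K] y - algebraMap K (A ⊗[K] B) c) ^ m = 0 ↔ n + 2 ≤ m := by
  have hvanish : (x ⊗ₜ[K] y - algebraMap K (A ⊗[K] B) c) ^ (n + 2) = 0 := by
    rw [tmul_sub_algebraMap_pow ((hx 2).2 le_rfl), (hy (n + 1 + 1)).2 (n + 1).le_succ,
      (hy _).2 le_rfl, mul_zero, TensorProduct.tmul_zero, TensorProduct.tmul_zero, smul_zero,
      add_zero]
  have hne : (x ⊗ₜ[K] y - algebraMap K (A ⊗[K] B) c) ^ (n + 1) ≠ 0 := by
    have heigen : y * (y - algebraMap K B c) ^ n = c • (y - algebraMap K B c) ^ n := by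
      rw [Algebra.smul_def]
      linear_combination (hy _).2 (le_refl (n + 1))
    rw [tmul_sub_algebraMap_pow ((hx 2).2 le_rfl), (hy _).2 le_rfl, TensorProduct.tmul_zero,
      zero_add, heigen, TensorProduct.tmul_smul]
    refine smul_ne_zero (Nat.cast_add_one_ne_zero n) (smul_ne_zero hc (tmul_ne_zero ?_ ?_))
    · exact fun h ↦ absurd ((hx 1).1 (by rw [pow_one, h])) (by norm_num)
    · exact fun h ↦ absurd ((hy n).1 h) (by omega)
  exact ⟨fun h ↦ by_contra fun hm ↦ hne (pow_eq_zero_of_le (by omega) h),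
    fun h ↦ pow_eq_zero_of_le h hvanish⟩

theorem root_sub_algebraMap_pow_eq_zero_iff (c : K) (a m : ℕ) :
    (AdjoinRoot.root ((X - C c) ^ a) - algebraMap K _ c) ^ m = 0 ↔ a ≤ m := by
  have h : (AdjoinRoot.root ((X - C c) ^ a) - algebraMap K _ c) ^ m =
      AdjoinRoot.mk _ ((X - C c) ^ m) := by
    rw [map_pow, map_sub, AdjoinRoot.mk_X, AdjoinRoot.mk_C, AdjoinRoot.algebraMap_eq]
  rw [h, AdjoinRoot.mk_eq_zero, pow_dvd_pow_iff (X_sub_C_ne_zero c) (not_isUnit_X_sub_C c)]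

theorem aeval_map_mulRoot_eq_zero_iff [CharZero K] (hc : c ≠ 0) (n m : ℕ) :
    aeval (TensorProduct.map (mulRoot ((X - C (1 : K)) ^ 2)) (mulRoot ((X - C c) ^ (n + 1))))
      ((X - C c) ^ m) = 0 ↔ n + 2 ≤ m := by
  have h : TensorProduct.map (mulRoot ((X - C (1 : K)) ^ 2)) (mulRoot ((X - C c) ^ (n + 1))) =
      Algebra.lmul K _ (AdjoinRoot.root ((X - C (1 : K)) ^ 2) ⊗ₜ[K]
        AdjoinRoot.root ((X - C c) ^ (n + 1))) :=
    TensorProduct.ext' fun _ _ ↦ (Algebra.TensorProduct.tmul_mul_tmul ..).symm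
  rw [h, aeval_lmul, map_pow, map_sub, aeval_X, aeval_C,
    map_eq_zero_iff _ Algebra.lmul_injective]
  refine tmul_sub_algebraMap_pow_eq_zero_iff (fun m ↦ ?_)
    (root_sub_algebraMap_pow_eq_zero_iff c (n + 1)) hc m
  have h1 := root_sub_algebraMap_pow_eq_zero_iff (1 : K) 2 m
  rwa [map_one (algebraMap K _)] at h1

end TensorUnipotent

/-! ### Presentation of a polynomial ring over a monoid algebra -/

section Presentation

variable (k G : Type*) [CommRing k] [CommMonoid G]

/-- The relations, among variables indexed by `G` and one further variable, which present the
polynomial ring in one variable over the monoid algebra of `G`. -/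
def monoidRelations : Ideal (MvPolynomial (G ⊕ Unit) k) :=
  Ideal.span
    (Set.range (fun x : G × G ↦ (MvPolynomial.X (.inl x.1) * MvPolynomial.X (.inl x.2) -
      MvPolynomial.X (.inl (x.1 * x.2)) : MvPolynomial (G ⊕ Unit) k)) ∪
    {MvPolynomial.X (.inl 1) - 1})

variable {k G} {B : Type*} [CommRing B] [Algebra k B]

variable (k) in
/-- The algebra homomorphism from the polynomial ring over the monoid algebra of `G` given by its
values on `G` and on the variable. -/
def monoidPolyLift (φ : G →* B) (b : B) : (MonoidAlgebra k G)[X] →ₐ[k] B :=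
  aevalTower (MonoidAlgebra.lift k B G φ) b

theorem monoidPolyLift_C_single (φ : G →* B) (b : B) (g : G) :
    monoidPolyLift k φ b (C (MonoidAlgebra.single g 1)) = φ g :=
  (aevalTower_C _ _ _).trans ((MonoidAlgebra.lift_single φ g 1).trans (one_smul k _))

theorem monoidPolyLift_X (φ : G →* B) (b : B) : monoidPolyLift k φ b X = b :=
  aevalTower_X _ _

theorem monoidPolyLift_comp_aeval (φ : G →* B) (b : B) :
    (monoidPolyLift k φ b).comp (MvPolynomial.aeval
      (Sum.elim (fun g ↦ C (MonoidAlgebra.single g 1)) fun _ : Unit ↦ X)) =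
    MvPolynomial.aeval (Sum.elim φ fun _ ↦ b) := by
  refine MvPolynomial.algHom_ext fun i ↦ ?_
  rw [AlgHom.comp_apply, MvPolynomial.aeval_X, MvPolynomial.aeval_X]
  cases i with
  | inl g => exact monoidPolyLift_C_single φ b g
  | inr _ => exact monoidPolyLift_X φ b

variable (k G) in
/-- The classes of the variables indexed by `G` modulo the relations. -/
def monoidGenerators : G →* MvPolynomial (G ⊕ Unit) k ⧸ monoidRelations k G where
  toFun g := Ideal.Quotient.mk _ (MvPolynomial.X (.inl g))
  map_one' := (Ideal.Quotient.eq (I := monoidRelations k G)).2 (Ideal.subset_span (Or.inr rfl))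
  map_mul' g h := by
    rw [← map_mul, eq_comm]
    exact (Ideal.Quotient.eq (I := monoidRelations k G)).2
      (Ideal.subset_span (Or.inl ⟨(g, h), rfl⟩))

theorem monoidPolyLift_generators_aeval (P : MvPolynomial (G ⊕ Unit) k) :
    monoidPolyLift k (monoidGenerators k G) (Ideal.Quotient.mk _ (MvPolynomial.X (.inr ())))
      (MvPolynomial.aeval (Sum.elim (fun g ↦ C (MonoidAlgebra.single g 1)) fun _ ↦ X) P) =
    Ideal.Quotient.mk (monoidRelations k G) P := by
  rw [← AlgHom.comp_apply, monoidPolyLift_comp_aeval]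
  refine AlgHom.congr_fun (φ₂ := Ideal.Quotient.mkₐ k (monoidRelations k G))
    (MvPolynomial.algHom_ext fun i ↦ ?_) P
  rw [MvPolynomial.aeval_X]
  cases i <;> rfl

theorem ker_aeval_eq_monoidRelations {φ : G →* B} {b : B}
    (h : Function.Injective (monoidPolyLift k φ b)) :
    RingHom.ker (MvPolynomial.aeval (R := k) (Sum.elim φ fun _ : Unit ↦ b)) =
      monoidRelations k G := by
  apply le_antisymm
  · intro P hP
    rw [RingHom.mem_ker, ← monoidPolyLift_comp_aeval, AlgHom.comp_apply,
      map_eq_zero_iff _ h] at hP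
    rw [← Ideal.Quotient.eq_zero_iff_mem, ← monoidPolyLift_generators_aeval, hP, map_zero]
  · refine Ideal.span_le.2 ?_
    rintro _ (⟨⟨x, y⟩, rfl⟩ | rfl)
    · simp [RingHom.mem_ker]
    · simp [RingHom.mem_ker]

end Presentation

/-! ### Extension of scalars of a Grothendieck ring -/

namespace GrothendieckRing

variable (k : Type*) [CommRing k] {S : Type*} [CommSemiring S]

/-- The class of an element in the Grothendieck ring with coefficients extended to `k`. -/
def baseChangeOf : S →+* k ⊗[ℤ] GrothendieckRing S where
  toFun s := 1 ⊗ₜ of s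
  map_zero' := by rw [map_zero, TensorProduct.tmul_zero]
  map_one' := rfl
  map_add' s t := by rw [map_add, TensorProduct.tmul_add]
  map_mul' s t := by rw [of_mul, Algebra.TensorProduct.tmul_mul_tmul, one_mul]

/-- The linear extension of an additive function to the Grothendieck ring with coefficients in
`k`. -/
def baseChangeLift {E : Type*} [AddCommGroup E] [Module k E] (f : S →+ E) :
    k ⊗[ℤ] GrothendieckRing S →ₗ[k] E :=
  TensorProduct.AlgebraTensorModule.lift
    (LinearMap.toSpanSingleton k (GrothendieckRing S →ₗ[ℤ] E) (lift f).toIntLinearMap)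

theorem baseChangeLift_baseChangeOf {E : Type*} [AddCommGroup E] [Module k E] (f : S →+ E)
    (s : S) : baseChangeLift k f (baseChangeOf k s) = f s := by
  change (1 : k) • lift f (of s) = f s
  rw [one_smul, lift_of]

theorem span_range_baseChangeOf :
    Submodule.span k (Set.range (baseChangeOf k (S := S))) = ⊤ := by
  refine eq_top_iff.2 fun x _ ↦ ?_
  have hone (x : GrothendieckRing S) :
      (1 : k) ⊗ₜ[ℤ] x ∈ Submodule.span k (Set.range (baseChangeOf k (S := S))) := by
    induction x using GrothendieckRing.induction with
    | of s => exact Submodule.subset_span ⟨s, rfl⟩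
    | sub x y hx hy =>
      rw [TensorProduct.tmul_sub]
      exact Submodule.sub_mem _ hx hy
  induction x using TensorProduct.induction_on with
  | zero => exact Submodule.zero_mem _
  | add x y hx hy => exact Submodule.add_mem _ (hx trivial) (hy trivial)
  | tmul a x =>
    rw [← mul_one a, ← smul_eq_mul, ← TensorProduct.smul_tmul']
    exact Submodule.smul_mem _ a (hone x)

end GrothendieckRing

end

noncomputable section

open TensorProduct

/-! ### The action of the invertible generator -/

namespace WeightModule

universe u

variable {R : Type u} [CommRing R]

/-- The generator `X` of `A(R, σ, 1)` as a unit, with inverse `Y`. -/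
def unitX (σ : RingAut R) : (GWA σ 1)ˣ where
  val := GWA.X σ 1
  inv := GWA.Y σ 1
  val_inv := by rw [GWA.X_mul_Y, map_one, map_one]
  inv_val := by rw [GWA.Y_mul_X, map_one]

variable {σ : RingAut R} {ω : Set (MaximalSpectrum R)}

theorem unitX_zpow_smul_smul (M : WeightModule σ 1 ω) (j : ℤ) (r : R) (m : M.carrier) :
    unitX σ ^ j • r • m = (σ ^ j) r • unitX σ ^ j • m := by
  induction j generalizing r m with
  | zero => simp only [zpow_zero, one_smul, RingAut.one_apply]
  | succ j ih =>
    rw [zpow_add_one, mul_smul, mul_smul, zpow_add_one, RingAut.mul_apply, ← ih]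
    exact congrArg _ (M.X_smul_smul r m)
  | pred j ih =>
    rw [zpow_sub_one, mul_smul, mul_smul, zpow_sub_one, RingAut.mul_apply, ← ih]
    exact congrArg _ (M.Y_smul_smul r m)

theorem Iso.of_addEquiv_unitX {M N : WeightModule σ 1 ω} (e : M.carrier ≃+ N.carrier)
    (hr : ∀ (r : R) m, e (r • m) = r • e m) (hX : ∀ m, e (unitX σ • m) = unitX σ • e m) :
    Iso M N :=
  Iso.of_addEquiv e hr hX fun m ↦ by
    change e ((unitX σ)⁻¹ • m) = (unitX σ)⁻¹ • e m
    rw [eq_inv_smul_iff, ← hX, smul_inv_smul]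

end WeightModule

namespace SkewLaurent

open LaurentPolynomial WeightModule

theorem rootQ_isPrimitiveRoot (p : ℕ) [NeZero p] : IsPrimitiveRoot (rootQ p) p :=
  IsPrimitiveRoot.coe_units_iff.1 (Complex.isPrimitiveRoot_exp p (NeZero.ne p))

theorem rootQ_zpow_pow (p : ℕ) [NeZero p] (j : ℤ) : (rootQ p ^ j) ^ p = 1 := by
  rw [← zpow_natCast, zpow_comm, zpow_natCast, rootQ_pow, one_zpow]

/-- The average of the powers of `z`, which takes the value `1` at the point `1` and `0` at the
other points of the orbit. It acts on a weight module as the projection to the weight space at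
`1`. -/
def baseIdem (p : ℕ) : ℂ[T;T⁻¹] :=
  C (p : ℂ)⁻¹ * ∑ i ∈ Finset.range p, T 1 ^ i

theorem evalAt_baseIdem (p : ℕ) (c : ℂˣ) :
    evalAt c (baseIdem p) = (p : ℂ)⁻¹ * ∑ i ∈ Finset.range p, (c : ℂ) ^ i := by
  simp only [baseIdem, map_mul, map_sum, map_pow, evalAt_C, evalAt_T]

theorem evalAt_one_baseIdem (p : ℕ) [NeZero p] : evalAt 1 (baseIdem p) = 1 := by
  simp [evalAt_baseIdem, NeZero.ne p]

theorem evalAt_baseIdem_of_ne_one {p : ℕ} {c : ℂˣ} (hc : c ^ p = 1) (h : c ≠ 1) :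
    evalAt c (baseIdem p) = 0 := by
  have hc' : (c : ℂ) ^ p = 1 := by rw [← Units.val_pow_eq_pow_val, hc, Units.val_one]
  rw [evalAt_baseIdem, geom_sum_eq (Units.val_eq_one.not.2 h), hc', sub_self, zero_div, mul_zero]

variable {p : ℕ} [NeZero p]

theorem sum_evalAt_scale_baseIdem {c : ℂˣ} (hc : c ^ p = 1) :
    ∑ j : Fin p, evalAt c (scale (rootQ p ^ (j : ℕ)) (baseIdem p)) = 1 := by
  have hq := rootQ_isPrimitiveRoot p
  obtain ⟨k, hk, hkc⟩ := hq.eq_pow_of_mem_rootsOfUnity (ξ := c⁻¹)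
    ((mem_rootsOfUnity ..).2 (by rw [inv_pow, hc, inv_one]))
  have hc' : c = (rootQ p ^ k)⁻¹ := by rw [hkc, inv_inv]
  simp only [evalAt_scale]
  rw [Finset.sum_eq_single ⟨k, hk⟩ (fun j _ hj ↦ ?_) (by simp), hkc, mul_inv_cancel,
    evalAt_one_baseIdem]
  refine evalAt_baseIdem_of_ne_one ?_ ?_
  · rw [mul_pow, hc, one_mul, ← pow_mul, mul_comm, pow_mul, rootQ_pow, one_pow]
  · rw [hc', Ne, inv_mul_eq_one]
    exact fun e ↦ hj (Fin.ext (hq.pow_inj hk j.2 e).symm)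

/-- The weight modules over `A(1)` supported on the orbit of `z - 1`. -/
abbrev OrbitModule (p : ℕ) [NeZero p] := WeightModule (sigma p) 1 (orbit p).carrier

namespace OrbitModule

variable (M : OrbitModule p)

theorem smul_eq_smul_of_evalAt {f g : ℂ[T;T⁻¹]}
    (h : ∀ c : ℂˣ, c ^ p = 1 → evalAt c f = evalAt c g) (m : M.carrier) : f • m = g • m := by
  rw [← sub_eq_zero, ← sub_smul]
  refine M.isWeight.smul_eq_zero (mem_idealOf.2 fun n hn ↦ ?_) m
  obtain ⟨k, -, rfl⟩ := (mem_orbit_iff p n).1 hn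
  refine (mem_pointIdeal _ _).2 ?_
  rw [map_sub, h _ (by rw [← pow_mul, mul_comm, pow_mul, rootQ_pow, one_pow]), sub_self]

theorem smul_baseIdem_smul (f : ℂ[T;T⁻¹]) (m : M.carrier) :
    f • baseIdem p • m = C (evalAt 1 f) • baseIdem p • m := by
  rw [← mul_smul, ← mul_smul]
  refine M.smul_eq_smul_of_evalAt (fun c hc ↦ ?_) m
  rw [map_mul, map_mul, evalAt_C]
  obtain rfl | h := eq_or_ne c 1
  · rfl
  · rw [evalAt_baseIdem_of_ne_one hc h, mul_zero, mul_zero]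

theorem baseIdem_smul_baseIdem_smul (m : M.carrier) :
    baseIdem p • baseIdem p • m = baseIdem p • m := by
  rw [smul_baseIdem_smul, evalAt_one_baseIdem, map_one, one_smul]

theorem sum_scale_baseIdem_smul (m : M.carrier) :
    ∑ j : Fin p, scale (rootQ p ^ (j : ℕ)) (baseIdem p) • m = m := by
  rw [← Finset.sum_smul]
  refine (M.smul_eq_smul_of_evalAt (fun c hc ↦ ?_) m).trans (one_smul ℂ[T;T⁻¹] m)
  rw [map_sum, map_one, sum_evalAt_scale_baseIdem hc]

theorem smul_unitX_zpow_smul (f : ℂ[T;T⁻¹]) (j : ℤ) (m : M.carrier) :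
    f • unitX (sigma p) ^ j • m = unitX (sigma p) ^ j • scale (rootQ p ^ j) f • m := by
  have h : (sigma p ^ j) (scale (rootQ p ^ j) f) = f := by
    rw [sigma, scale_zpow, ← RingAut.mul_apply, ← scale_mul, inv_zpow, inv_mul_cancel,
      scale_apply, scaleHom_one, RingHom.id_apply]
  rw [unitX_zpow_smul_smul, h]

theorem smul_unitX_pow_smul (f : ℂ[T;T⁻¹]) (m : M.carrier) :
    f • unitX (sigma p) ^ p • m = unitX (sigma p) ^ p • f • m := by
  have h := M.smul_unitX_zpow_smul f p m
  rwa [zpow_natCast, zpow_natCast, rootQ_pow, scale_apply, scaleHom_one, RingHom.id_apply] at h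

end OrbitModule

open OrbitModule

/-! ### The fibre of a weight module at the point `1` -/

instance : RingHomCompTriple (C : ℂ →+* ℂ[T;T⁻¹]) (evalAt 1) (RingHom.id ℂ) :=
  ⟨RingHom.ext (evalAt_C 1)⟩

/-- An identification of the weight space of `M` at the point `1` with a complex vector space `W`
under which the monodromy `X ^ p` of the weight space becomes `F`. -/
structure Fiber (M : OrbitModule p) (W : Type*) [AddCommGroup W] [Module ℂ W]
    (F : Module.End ℂ W) where
  /-- The inclusion of the weight space. -/
  incl : W →ₛₗ[(C : ℂ →+* ℂ[T;T⁻¹])] M.carrier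
  /-- The projection to the weight space. -/
  proj : M.carrier →ₛₗ[evalAt 1] W
  proj_incl : ∀ w, proj (incl w) = w
  incl_proj : ∀ m, incl (proj m) = baseIdem p • m
  unitX_pow_smul_incl : ∀ w, unitX (sigma p) ^ p • incl w = incl (F w)

namespace Fiber

variable {M N : OrbitModule p} {W W' : Type*} [AddCommGroup W] [Module ℂ W] [AddCommGroup W']
  [Module ℂ W'] {F : Module.End ℂ W} {F' : Module.End ℂ W'}

theorem smul_incl (D : Fiber M W F) (f : ℂ[T;T⁻¹]) (w : W) :
    f • D.incl w = D.incl (evalAt 1 f • w) := by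
  rw [map_smulₛₗ, ← D.proj_incl w, D.incl_proj, smul_baseIdem_smul]

theorem incl_injective (D : Fiber M W F) : Function.Injective D.incl :=
  Function.LeftInverse.injective D.proj_incl

theorem finite (D : Fiber M W F) : Module.Finite ℂ W :=
  have := M.isWeight.moduleFinite (orbit p).finite
  .of_surjective D.proj (Function.RightInverse.surjective D.proj_incl)

theorem injective (D : Fiber M W F) : Function.Injective F := fun v w h ↦ by
  refine D.incl_injective (MulAction.injective (unitX (sigma p) ^ p) ?_)
  simp only [D.unitX_pow_smul_incl, h]

theorem proj_unitX_pow_smul (D : Fiber M W F) (m : M.carrier) :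
    D.proj (unitX (sigma p) ^ p • m) = F (D.proj m) := by
  apply D.incl_injective
  rw [← D.unitX_pow_smul_incl, D.incl_proj, D.incl_proj, smul_unitX_pow_smul]

theorem proj_unitX_zpow_smul_incl (D : Fiber M W F) {j : ℤ} (hj : rootQ p ^ j ≠ 1) (w : W) :
    D.proj (unitX (sigma p) ^ j • D.incl w) = 0 := by
  apply D.incl_injective
  rw [D.incl_proj, smul_unitX_zpow_smul, D.smul_incl, evalAt_scale, one_mul,
    evalAt_baseIdem_of_ne_one (rootQ_zpow_pow p j) hj, zero_smul, map_zero, smul_zero]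

/-- The coordinates of a vector with respect to `M = ⨁ⱼ X⁻ʲ M₁`: the `j`-th one is the projection
of the translate by `X ^ j`. -/
def coords (D : Fiber M W F) : M.carrier ≃+ (Fin p → W) where
  toFun m j := D.proj (unitX (sigma p) ^ (j : ℤ) • m)
  invFun w := ∑ j : Fin p, unitX (sigma p) ^ (-j : ℤ) • D.incl (w j)
  left_inv m := by
    refine (Finset.sum_congr rfl fun j _ ↦ ?_).trans (M.sum_scale_baseIdem_smul m)
    rw [D.incl_proj, smul_unitX_zpow_smul, zpow_neg, inv_smul_smul, zpow_natCast]
  right_inv w := funext fun i ↦ by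
    dsimp only
    rw [Finset.smul_sum, map_sum, Finset.sum_eq_single i (fun j _ hj ↦ ?_) (by simp), zpow_neg,
      smul_inv_smul, D.proj_incl]
    rw [← mul_smul, ← zpow_add]
    refine D.proj_unitX_zpow_smul_incl (fun h ↦ hj ?_) _
    rw [zpow_add, zpow_neg, mul_inv_eq_one, zpow_natCast, zpow_natCast] at h
    exact Fin.ext ((rootQ_isPrimitiveRoot p).pow_inj i.2 j.2 h).symm
  map_add' m n := funext fun j ↦ by rw [smul_add, map_add]; rfl

theorem coords_apply (D : Fiber M W F) (m : M.carrier) (j : Fin p) :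
    D.coords m j = D.proj (unitX (sigma p) ^ (j : ℤ) • m) := rfl

theorem coords_smul (D : Fiber M W F) (f : ℂ[T;T⁻¹]) (m : M.carrier) (j : Fin p) :
    D.coords (f • m) j = evalAt 1 ((sigma p ^ (j : ℤ)) f) • D.coords m j := by
  rw [coords_apply, unitX_zpow_smul_smul, map_smulₛₗ, coords_apply]

theorem coords_unitX_smul (D : Fiber M W F) (m : M.carrier) (j : Fin p) :
    D.coords (unitX (sigma p) • m) j =
      if h : (j : ℕ) + 1 < p then D.coords m ⟨j + 1, h⟩ else F (D.coords m 0) := by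
  rw [coords_apply, ← mul_smul, ← zpow_add_one]
  split_ifs with h
  · rfl
  · have hj : (j : ℤ) + 1 = p := by have := j.2; omega
    rw [hj, zpow_natCast, proj_unitX_pow_smul, coords_apply, Fin.val_zero, Nat.cast_zero,
      zpow_zero, one_smul]

theorem iso (D : Fiber M W F) (E : Fiber N W F) : WeightModule.Iso M N := by
  refine Iso.of_addEquiv_unitX (D.coords.trans E.coords.symm) (fun f m ↦ ?_) fun m ↦ ?_ <;>
    apply E.coords.injective <;> funext j
  · simp only [AddEquiv.trans_apply, AddEquiv.apply_symm_apply, coords_smul]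
  · simp only [AddEquiv.trans_apply, AddEquiv.apply_symm_apply, coords_unitX_smul]

theorem proj_incl_proj_incl (D : Fiber M W F) (E : Fiber M W' F') (w : W) :
    D.proj (E.incl (E.proj (D.incl w))) = w := by
  rw [E.incl_proj, D.smul_incl, evalAt_one_baseIdem, one_smul, D.proj_incl]

theorem exists_semiconj (D : Fiber M W F) (E : Fiber M W' F') :
    ∃ e : W ≃ₗ[ℂ] W', Function.Semiconj e F F' := by
  refine ⟨.ofLinearMap (E.proj.comp D.incl) (D.proj.comp E.incl)
    (LinearMap.ext (E.proj_incl_proj_incl D)) (LinearMap.ext (D.proj_incl_proj_incl E)),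
    fun w ↦ ?_⟩
  change E.proj (D.incl (F w)) = F' (E.proj (D.incl w))
  rw [← D.unitX_pow_smul_incl, E.proj_unitX_pow_smul]

/-- Transport of a fibre along an isomorphism of weight modules. -/
def ofIso (D : Fiber M W F) (e : M.carrier ≃ₗ[GWA (sigma p) 1] N.carrier) : Fiber N W F where
  incl := (baseEquiv e).toLinearMap.comp D.incl
  proj := D.proj.comp (baseEquiv e).symm.toLinearMap
  proj_incl w := by
    change D.proj ((baseEquiv e).symm (baseEquiv e (D.incl w))) = w
    rw [LinearEquiv.symm_apply_apply, D.proj_incl]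
  incl_proj m := by
    change baseEquiv e (D.incl (D.proj ((baseEquiv e).symm m))) = _
    rw [D.incl_proj, map_smul, LinearEquiv.apply_symm_apply]
  unitX_pow_smul_incl w := by
    change _ • e (D.incl w) = e (D.incl _)
    rw [← D.unitX_pow_smul_incl, Units.smul_def, Units.smul_def, map_smul]

/-- Transport of a fibre along an isomorphism of vector spaces with endomorphisms. -/
def conj (D : Fiber M W F) (e : W ≃ₗ[ℂ] W') (h : Function.Semiconj e F F') : Fiber M W' F' where
  incl := D.incl.comp e.symm.toLinearMap
  proj := e.toLinearMap.comp D.proj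
  proj_incl w := by
    change e (D.proj (D.incl (e.symm w))) = w
    rw [D.proj_incl, e.apply_symm_apply]
  incl_proj m := by
    change D.incl (e.symm (e (D.proj m))) = _
    rw [e.symm_apply_apply, D.incl_proj]
  unitX_pow_smul_incl w := by
    change _ • D.incl (e.symm w) = D.incl (e.symm _)
    rw [D.unitX_pow_smul_incl, e.eq_symm_apply.2 (h _), e.apply_symm_apply]

/-- The fibre of a direct sum is the direct sum of the fibres. -/
def directSum (D : Fiber M W F) (E : Fiber N W' F') :
    Fiber (M.directSum N) (W × W') (F.prodMap F') where
  incl := { D.incl.toAddMonoidHom.prodMap E.incl.toAddMonoidHom with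
    map_smul' := fun c w ↦ Prod.ext (map_smulₛₗ D.incl c w.1) (map_smulₛₗ E.incl c w.2) }
  proj := { D.proj.toAddMonoidHom.prodMap E.proj.toAddMonoidHom with
    map_smul' := fun f m ↦ Prod.ext (map_smulₛₗ D.proj f m.1) (map_smulₛₗ E.proj f m.2) }
  proj_incl w := Prod.ext (D.proj_incl w.1) (E.proj_incl w.2)
  incl_proj m := Prod.ext (D.incl_proj m.1) (E.incl_proj m.2)
  unitX_pow_smul_incl w := Prod.ext (D.unitX_pow_smul_incl w.1) (E.unitX_pow_smul_incl w.2)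

/-- The fibre of the zero module is zero. -/
def zero [Subsingleton W] (F : Module.End ℂ W) :
    Fiber (WeightModule.zero (sigma p) 1 (orbit p)) W F where
  incl := 0
  proj := 0
  proj_incl _ := Subsingleton.elim _ _
  incl_proj _ := rfl
  unitX_pow_smul_incl _ := rfl

theorem unitX_pow_smul_tmul (j : ℕ) (m : M.carrier) (n : N.carrier) :
    unitX (sigma p) ^ j • tmul M N (one_mul 1) m n =
      tmul M N (one_mul 1) (unitX (sigma p) ^ j • m) (unitX (sigma p) ^ j • n) := by
  induction j with
  | zero => simp only [pow_zero, one_smul]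
  | succ j ih =>
    rw [pow_succ', mul_smul, ih, mul_smul, mul_smul]
    exact X_smul_tmul ..

/-- The inclusion of the tensor product of two fibres. -/
def tensorIncl (D : Fiber M W F) (E : Fiber N W' F') :
    W ⊗[ℂ] W' →ₛₗ[(C : ℂ →+* ℂ[T;T⁻¹])] (M.tensor N (one_mul 1)).carrier :=
  TensorProduct.map D.incl E.incl

theorem tensorIncl_tmul (D : Fiber M W F) (E : Fiber N W' F') (w : W) (w' : W') :
    D.tensorIncl E (w ⊗ₜ w') = tmul M N (one_mul 1) (D.incl w) (E.incl w') := rfl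

/-- The projection to the tensor product of two fibres. -/
def tensorProj (D : Fiber M W F) (E : Fiber N W' F') :
    (M.tensor N (one_mul 1)).carrier →ₛₗ[evalAt 1] W ⊗[ℂ] W' :=
  TensorProduct.map D.proj E.proj

theorem tensorProj_tmul (D : Fiber M W F) (E : Fiber N W' F') (m : M.carrier) (n : N.carrier) :
    D.tensorProj E (tmul M N (one_mul 1) m n) = D.proj m ⊗ₜ E.proj n := rfl

/-- The fibre of a tensor product over `ℂ[z, z⁻¹]` is the tensor product of the fibres over
`ℂ`. -/
def tensor (D : Fiber M W F) (E : Fiber N W' F') :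
    Fiber (M.tensor N (one_mul 1)) (W ⊗[ℂ] W') (TensorProduct.map F F') where
  incl := D.tensorIncl E
  proj := D.tensorProj E
  proj_incl x := by
    induction x using TensorProduct.induction_on with
    | zero => rw [map_zero, map_zero]
    | tmul w w' => rw [tensorIncl_tmul, tensorProj_tmul, D.proj_incl, E.proj_incl]
    | add x y hx hy => rw [map_add, map_add, hx, hy]
  incl_proj x := by
    induction x using tensor_induction with
    | zero => rw [map_zero, map_zero, smul_zero]
    | tmul m n =>
      rw [tensorProj_tmul, tensorIncl_tmul, D.incl_proj, E.incl_proj]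
      refine (TensorProduct.smul_tmul _ _ _).symm.trans ?_
      rw [baseIdem_smul_baseIdem_smul]
      rfl
    | add x y hx hy => rw [map_add, map_add, hx, hy, smul_add]
  unitX_pow_smul_incl x := by
    induction x using TensorProduct.induction_on with
    | zero => rw [map_zero, map_zero, map_zero, smul_zero]
    | tmul w w' =>
      rw [tensorIncl_tmul, unitX_pow_smul_tmul, D.unitX_pow_smul_incl, E.unitX_pow_smul_incl,
        TensorProduct.map_tmul, tensorIncl_tmul]
    | add x y hx hy => rw [map_add, smul_add, hx, hy, map_add, map_add]

end Fiber

/-- The weight space at the point `1`, as a complex vector space. -/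
def FiberSpace (M : OrbitModule p) : Type := weightSpace M.carrier (point 1)

namespace FiberSpace

variable (M : OrbitModule p)

instance : AddCommGroup (FiberSpace M) :=
  inferInstanceAs (AddCommGroup (weightSpace M.carrier (point 1)))

instance : Module ℂ[T;T⁻¹] (FiberSpace M) :=
  inferInstanceAs (Module ℂ[T;T⁻¹] (weightSpace M.carrier (point 1)))

instance : Module ℂ (FiberSpace M) := Module.compHom _ (C : ℂ →+* ℂ[T;T⁻¹])

/-- The inclusion of the weight space. -/
def val : FiberSpace M →ₗ[ℂ[T;T⁻¹]] M.carrier := Submodule.subtype _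

theorem smul_eq (f : ℂ[T;T⁻¹]) (w : FiberSpace M) : f • w = evalAt 1 f • w := by
  change f • w = C (evalAt 1 f) • w
  rw [← sub_eq_zero, ← sub_smul]
  have hf : f - C (evalAt 1 f) ∈ pointIdeal 1 := by
    rw [mem_pointIdeal, map_sub, evalAt_C, sub_self]
  exact Subtype.ext ((Submodule.mem_torsionBySet_iff _ _).1 w.2 ⟨_, hf⟩)

theorem mem_weightSpace_iff (m : M.carrier) :
    m ∈ weightSpace M.carrier (point 1) ↔ baseIdem p • m = m := by
  refine ⟨fun hm ↦ ?_, fun hm ↦ (Submodule.mem_torsionBySet_iff _ _).2 fun f ↦ ?_⟩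
  · obtain ⟨w, rfl⟩ : ∃ w : FiberSpace M, val M w = m := ⟨⟨m, hm⟩, rfl⟩
    rw [← map_smul, smul_eq, evalAt_one_baseIdem, one_smul]
  · rw [← hm]
    refine (M.smul_baseIdem_smul f m).trans ?_
    rw [(mem_pointIdeal 1 _).1 f.2, map_zero, zero_smul]

theorem baseIdem_smul_val (w : FiberSpace M) : baseIdem p • val M w = val M w :=
  (mem_weightSpace_iff M _).1 w.2

/-- The monodromy of `M`: the action of `X ^ p` on the weight space at the point `1`. -/
def monodromy : Module.End ℂ (FiberSpace M) where
  toFun w := ⟨unitX (sigma p) ^ p • val M w, (mem_weightSpace_iff M _).2 <| by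
    rw [smul_unitX_pow_smul, baseIdem_smul_val]⟩
  map_add' v w := Subtype.ext <| by
    change unitX (sigma p) ^ p • val M (v + w) = _
    rw [map_add, smul_add]
    rfl
  map_smul' c w := Subtype.ext (M.smul_unitX_pow_smul (C c) (val M w)).symm

/-- The tautological fibre of a weight module. -/
def fiber : Fiber M (FiberSpace M) (monodromy M) where
  incl := { (val M).toAddMonoidHom with map_smul' := fun _ _ ↦ rfl }
  proj :=
    { toFun := fun m ↦ ⟨baseIdem p • m,
        (mem_weightSpace_iff M _).2 (baseIdem_smul_baseIdem_smul M m)⟩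
      map_add' := fun m n ↦ Subtype.ext (smul_add (baseIdem p) m n)
      map_smul' := fun f m ↦ Subtype.ext <|
        (smul_comm (baseIdem p) f m).trans (M.smul_baseIdem_smul f m) }
  proj_incl w := Subtype.ext (baseIdem_smul_val M w)
  incl_proj _ := rfl
  unitX_pow_smul_incl _ := rfl

end FiberSpace

/-! ### The fibres of the modules attached to invertible matrices -/

theorem weight_eq_one_iff (k : Fin p) : weight p k = 1 ↔ k = -1 := by
  obtain ⟨k, rfl⟩ : ∃ j, k = j - 1 := ⟨k + 1, (add_sub_cancel_right k 1).symm⟩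
  have h : weight p (k - 1) = rootQ p ^ (k : ℕ) :=
    mul_right_cancel (by rw [← weight_add_one, sub_add_cancel, weight, pow_succ])
  rw [h, (rootQ_isPrimitiveRoot p).pow_eq_one_iff_dvd, sub_eq_neg_self, Fin.ext_iff,
    Fin.val_zero]
  exact ⟨fun hk ↦ Nat.eq_zero_of_dvd_of_lt hk k.2, fun hk ↦ hk ▸ dvd_zero p⟩

namespace CircleSpace

variable {d : ℕ}

/-- The vector concentrated in the `i`-th summand. -/
def single {p : ℕ} (i : Fin p) : (Fin d → ℂ) →+ CircleSpace p d :=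
  AddMonoidHom.single (fun _ : Fin p ↦ Fin d → ℂ) i

theorem single_apply {p : ℕ} (i k : Fin p) (w : Fin d → ℂ) :
    single i w k = if k = i then w else 0 := Pi.single_apply ..

theorem smul_single {p : ℕ} (f : ℂ[T;T⁻¹]) (i : Fin p) (w : Fin d → ℂ) :
    f • single i w = single i (evalAt (weight p i) f • w) := by
  funext k
  rw [smul_apply, single_apply, single_apply]
  split_ifs with h
  · rw [h]
  · exact smul_zero _

theorem baseIdem_smul (v : CircleSpace p d) : baseIdem p • v = single (-1) (v (-1)) := by
  funext k
  rw [smul_apply, single_apply]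
  split_ifs with h
  · rw [(weight_eq_one_iff k).2 h, evalAt_one_baseIdem, one_smul, h]
  · have hk : weight p k ^ p = 1 := by
      rw [weight, ← pow_mul, mul_comm, pow_mul, rootQ_pow, one_pow]
    rw [evalAt_baseIdem_of_ne_one hk ((weight_eq_one_iff k).not.2 h), zero_smul]

open Matrix in
theorem actX_single (F : GL (Fin d) ℂ) (i : Fin p) (w : Fin d → ℂ) :
    actX F (single i w) = single (i + 1) (if i + 1 = 0 then F.1 *ᵥ w else w) := by
  funext k
  rw [actX_apply, single_apply, single_apply]
  by_cases h : k = i + 1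
  · subst h
    simp
  · simp [h, mt sub_eq_iff_eq_add.1 h]

theorem unitX_smul (F : GL (Fin d) ℂ) (v : (circleModule p F).carrier) :
    unitX (sigma p) • v = actX F v :=
  WeightModule.of_X_smul ..

open Matrix in
theorem unitX_pow_succ_smul_single (F : GL (Fin d) ℂ) (w : Fin d → ℂ) (j : ℕ) (hj : j < p) :
    unitX (sigma p) ^ (j + 1) • (show (circleModule p F).carrier from single (-1) w) =
      single ⟨j, hj⟩ (F.1 *ᵥ w) := by
  induction j with
  | zero =>
    rw [zero_add, pow_one]
    refine (unitX_smul F _).trans ((actX_single F _ w).trans ?_)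
    rw [neg_add_cancel, if_pos rfl]
    rfl
  | succ j ih =>
    have h : (⟨j, by omega⟩ : Fin p) + 1 = ⟨j + 1, hj⟩ := by
      refine Fin.ext ?_
      rw [Fin.val_add, Fin.val_one', Nat.add_mod_mod, Nat.mod_eq_of_lt hj]
    rw [pow_succ', mul_smul, ih (by omega)]
    refine (unitX_smul F _).trans ((actX_single F _ _).trans ?_)
    rw [h, if_neg]
    exact fun e ↦ absurd (Fin.ext_iff.1 e) (Nat.succ_ne_zero j)

end CircleSpace

/-- The fibre of the module attached to an invertible matrix: the last of the summands, which
carries the weight `q ^ p = 1`. -/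
def circleFiber {d : ℕ} (F : GL (Fin d) ℂ) :
    Fiber (circleModule p F) (Fin d → ℂ) (Matrix.toLin' F.1) where
  incl :=
    { CircleSpace.single (-1) with
      map_smul' := fun c w ↦ by
        have h := CircleSpace.smul_single (C c) (-1 : Fin p) w
        rw [evalAt_C] at h
        exact h.symm }
  proj :=
    { Pi.evalAddMonoidHom (fun _ : Fin p ↦ Fin d → ℂ) (-1) with
      map_smul' := fun f v ↦ by
        have h := CircleSpace.smul_apply f (v : CircleSpace p d) (-1)
        rw [(weight_eq_one_iff _).2 rfl] at h
        exact h }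
  proj_incl w := Pi.single_eq_same ..
  incl_proj v := (CircleSpace.baseIdem_smul v).symm
  unitX_pow_smul_incl w := by
    have hp := Nat.sub_add_cancel (NeZero.pos p)
    have e : (⟨p - 1, Nat.sub_one_lt (NeZero.ne p)⟩ : Fin p) = -1 := by
      rw [← weight_eq_one_iff, weight, hp, rootQ_pow]
    have h := CircleSpace.unitX_pow_succ_smul_single F w (p - 1) (Nat.sub_one_lt (NeZero.ne p))
    rw [hp, e] at h
    exact h

end SkewLaurent

end

noncomputable section

open Polynomial TensorProduct

theorem exists_companion_equiv {f : ℂ[X]} (hf : f.Monic) :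
    ∃ e : (Fin f.natDegree → ℂ) ≃ₗ[ℂ] AdjoinRoot f,
      Function.Semiconj e (Matrix.toLin' (SkewLaurent.companion f)) (mulRoot f) := by
  let B := AdjoinRoot.powerBasis' hf
  have hminpoly : B.minpolyGen = f :=
    (PowerBasis.minpolyGen_eq B).trans (AdjoinRoot.minpoly_powerBasis_gen_of_monic hf)
  have hmatrix : Algebra.leftMulMatrix B.basis B.gen = SkewLaurent.companion f := by
    rw [PowerBasis.leftMulMatrix, hminpoly]
    ext i j
    simp only [SkewLaurent.companion, Matrix.of_apply, hf.leadingCoeff, div_one]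
    rfl
  have h := equivFun_symm_semiconj_leftMulMatrix B.basis B.gen
  rw [hmatrix] at h
  exact ⟨B.basis.equivFun.symm, h⟩

namespace SkewLaurent

open GrothendieckRing

variable {p : ℕ} [NeZero p]

/-! ### The monodromy of an isomorphism class -/

/-- Some representative, hence each one, of the isomorphism class `c` has monodromy `F` on its
weight space at the point `1`, up to conjugacy. -/
def HasMonodromy (c : IsoClass (orbit p)) {W : Type*} [AddCommGroup W] [Module ℂ W]
    (F : Module.End ℂ W) : Prop :=
  ∃ M : OrbitModule p, IsoClass.mk M = c ∧ Nonempty (Fiber M W F)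

theorem exists_hasMonodromy (c : IsoClass (orbit p)) :
    ∃ M : OrbitModule p, HasMonodromy c (FiberSpace.monodromy M) := by
  induction c using Quotient.inductionOn with
  | h M => exact ⟨M, M, rfl, ⟨FiberSpace.fiber M⟩⟩

namespace HasMonodromy

variable {c c' : IsoClass (orbit p)} {W W' : Type*} [AddCommGroup W] [Module ℂ W]
  [AddCommGroup W'] [Module ℂ W'] {F : Module.End ℂ W} {F' : Module.End ℂ W'}

theorem unique (h : HasMonodromy c F) (h' : HasMonodromy c' F) : c = c' := by
  obtain ⟨M, rfl, ⟨D⟩⟩ := h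
  obtain ⟨N, rfl, ⟨E⟩⟩ := h'
  exact IsoClass.mk_eq_mk.2 (D.iso E)

theorem conj (h : HasMonodromy c F) (e : W ≃ₗ[ℂ] W') (he : Function.Semiconj e F F') :
    HasMonodromy c F' := by
  obtain ⟨M, rfl, ⟨D⟩⟩ := h
  exact ⟨M, rfl, ⟨D.conj e he⟩⟩

theorem add (h : HasMonodromy c F) (h' : HasMonodromy c' F') :
    HasMonodromy (c + c') (F.prodMap F') := by
  obtain ⟨M, rfl, ⟨D⟩⟩ := h
  obtain ⟨N, rfl, ⟨E⟩⟩ := h'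
  exact ⟨M.directSum N, rfl, ⟨D.directSum E⟩⟩

theorem mul (h : HasMonodromy c F) (h' : HasMonodromy c' F') :
    HasMonodromy (c * c') (TensorProduct.map F F') := by
  obtain ⟨M, rfl, ⟨D⟩⟩ := h
  obtain ⟨N, rfl, ⟨E⟩⟩ := h'
  exact ⟨M.tensor N (one_mul 1), rfl, ⟨D.tensor E⟩⟩

theorem zero [Subsingleton W] (F : Module.End ℂ W) : HasMonodromy (0 : IsoClass (orbit p)) F :=
  ⟨_, rfl, ⟨Fiber.zero F⟩⟩

theorem sum {n : ℕ} {c : Fin n → IsoClass (orbit p)} {W : Fin n → Type*}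
    [∀ i, AddCommGroup (W i)] [∀ i, Module ℂ (W i)] {F : ∀ i, Module.End ℂ (W i)}
    (h : ∀ i, HasMonodromy (c i) (F i)) : HasMonodromy (∑ i, c i) (LinearMap.piMap F) := by
  induction n with
  | zero => rw [Fin.sum_univ_zero]; exact zero _
  | succ n ih =>
    rw [Fin.sum_univ_succ]
    refine ((h 0).add (ih fun i ↦ h i.succ)).conj (Fin.consLinearEquiv ℂ W) fun w ↦ ?_
    funext i
    cases i using Fin.cases <;> rfl

theorem finite (h : HasMonodromy c F) : Module.Finite ℂ W := by
  obtain ⟨M, -, ⟨D⟩⟩ := h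
  exact D.finite

theorem injective (h : HasMonodromy c F) : Function.Injective F := by
  obtain ⟨M, -, ⟨D⟩⟩ := h
  exact D.injective

end HasMonodromy

/-! ### Jordan blocks -/

variable (p) in
/-- The isomorphism class of the module attached to the companion matrix of `(x - ξ) ^ a`; its
monodromy is a Jordan block. -/
def block (ξ : ℂˣ) (a : ℕ) : IsoClass (orbit p) :=
  IsoClass.mk (circleModule p (companion_isUnit (coeff_zero_ne ξ a)).unit)

theorem block_hasMonodromy (ξ : ℂˣ) (a : ℕ) :
    HasMonodromy (block p ξ a) (mulRoot ((X - C (ξ : ℂ)) ^ a)) := by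
  obtain ⟨e, he⟩ := exists_companion_equiv ((monic_X_sub_C (ξ : ℂ)).pow a)
  exact ⟨_, rfl, ⟨(circleFiber _).conj e he⟩⟩

theorem block_one_hasMonodromy (ξ : ℂˣ) :
    HasMonodromy (block p ξ 1) (Algebra.lmul ℂ ℂ (ξ : ℂ)) := by
  have h := block_hasMonodromy (p := p) ξ 1
  rw [pow_one] at h
  obtain ⟨e, he⟩ := exists_mulRoot_X_sub_C_equiv (ξ : ℂ)
  exact h.conj e he

theorem HasMonodromy.block_one_mul (ξ : ℂˣ) {c : IsoClass (orbit p)} {W : Type*} [AddCommGroup W]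
    [Module ℂ W] {F : Module.End ℂ W} (h : HasMonodromy c F) :
    HasMonodromy (block p ξ 1 * c) ((ξ : ℂ) • F) := by
  refine ((block_one_hasMonodromy ξ).mul h).conj (TensorProduct.lid ℂ W) fun w ↦ ?_
  induction w using TensorProduct.induction_on with
  | zero => simp only [map_zero]
  | tmul a w => simp [mul_smul, smul_comm a]
  | add v w hv hw => rw [map_add, map_add, hv, hw, map_add, map_add]

theorem block_one_one : block p 1 1 = 1 := by
  have one_mul (c : IsoClass (orbit p)) : block p 1 1 * c = c := by
    obtain ⟨M, hM⟩ := exists_hasMonodromy c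
    have h := hM.block_one_mul 1
    rw [Units.val_one, one_smul] at h
    exact h.unique hM
  rw [← mul_one (block p 1 1), one_mul]

theorem block_mul_block (ξ η : ℂˣ) : block p ξ 1 * block p η 1 = block p (ξ * η) 1 := by
  have h := (block_one_hasMonodromy (p := p) η).block_one_mul ξ
  rw [← map_smul, smul_eq_mul, ← Units.val_mul] at h
  exact h.unique (block_one_hasMonodromy _)

theorem block_zero (ξ : ℂˣ) : block p ξ 0 = 0 := by
  have : Subsingleton (AdjoinRoot ((X - C (ξ : ℂ)) ^ 0)) :=
    Ideal.Quotient.subsingleton_iff.2 (by rw [pow_zero, Ideal.span_singleton_one])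
  exact (block_hasMonodromy ξ 0).unique (HasMonodromy.zero _)

theorem exists_eq_sum_block (c : IsoClass (orbit p)) :
    ∃ (n : ℕ) (ξ : Fin n → ℂˣ) (a : Fin n → ℕ), c = ∑ i, block p (ξ i) (a i) := by
  obtain ⟨M, hM⟩ := exists_hasMonodromy c
  have := hM.finite
  obtain ⟨n, z, a, e, he⟩ := exists_semiconj_mulRoot_piMap (FiberSpace.monodromy M)
  have hsum := hM.conj e he
  have hinj := hsum.injective
  rw [LinearMap.coe_piMap, Pi.map_injective] at hinj
  choose ξ hξ using fun i ↦ exists_units_X_sub_C_pow_eq (hinj i)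
  exact ⟨n, ξ, a, hsum.unique <| HasMonodromy.sum fun i ↦ by
    rw [hξ i]
    exact block_hasMonodromy _ _⟩

/-! ### Ranks -/

/-- The rank of `g(X ^ p)` on the weight space at the point `1`. -/
def classRank (g : ℂ[X]) (c : IsoClass (orbit p)) : ℕ :=
  Quotient.liftOn c (fun M ↦ polyRank (FiberSpace.monodromy M) g) fun M N ⟨e⟩ ↦ by
    obtain ⟨f, hf⟩ := ((FiberSpace.fiber M).ofIso e).exists_semiconj (FiberSpace.fiber N)
    exact polyRank_congr f hf g

theorem HasMonodromy.classRank_eq {c : IsoClass (orbit p)} {W : Type*} [AddCommGroup W]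
    [Module ℂ W] {F : Module.End ℂ W} (h : HasMonodromy c F) (g : ℂ[X]) :
    classRank g c = polyRank F g := by
  obtain ⟨M, rfl, ⟨D⟩⟩ := h
  obtain ⟨f, hf⟩ := (FiberSpace.fiber M).exists_semiconj D
  exact polyRank_congr f hf g

variable (p) in
/-- `classRank` as an additive map. -/
def classRankHom (g : ℂ[X]) : IsoClass (orbit p) →+ ℕ where
  toFun := classRank g
  map_zero' := by
    rw [(HasMonodromy.zero (W := PUnit.{1}) 0).classRank_eq, polyRank_eq_zero_iff]
    exact Subsingleton.elim _ _
  map_add' c c' := by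
    obtain ⟨M, h⟩ := exists_hasMonodromy c
    obtain ⟨N, h'⟩ := exists_hasMonodromy c'
    have := h.finite
    have := h'.finite
    rw [(h.add h').classRank_eq, h.classRank_eq, h'.classRank_eq, polyRank_prodMap]

theorem HasMonodromy.classRankHom_eq {c : IsoClass (orbit p)} {W : Type*} [AddCommGroup W]
    [Module ℂ W] {F : Module.End ℂ W} (h : HasMonodromy c F) (g : ℂ[X]) :
    classRankHom p g c = polyRank F g := h.classRank_eq g

theorem HasMonodromy.classRankHom_eq_zero_iff {c : IsoClass (orbit p)} {W : Type*}
    [AddCommGroup W] [Module ℂ W] {F : Module.End ℂ W} (h : HasMonodromy c F) (g : ℂ[X]) :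
    classRankHom p g c = 0 ↔ aeval F g = 0 := by
  have := h.finite
  rw [h.classRankHom_eq, polyRank_eq_zero_iff]

theorem classRankHom_block_eq_zero_iff (g : ℂ[X]) (ξ : ℂˣ) (a : ℕ) :
    classRankHom p g (block p ξ a) = 0 ↔ (X - C (ξ : ℂ)) ^ a ∣ g := by
  rw [(block_hasMonodromy ξ a).classRankHom_eq_zero_iff, aeval_mulRoot_eq_zero_iff]

theorem classRankHom_block_of_ne {ξ η : ℂˣ} (h : ξ ≠ η) (a k : ℕ) :
    classRankHom p ((X - C (ξ : ℂ)) ^ k) (block p η a) =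
      Module.finrank ℂ (AdjoinRoot ((X - C (η : ℂ)) ^ a)) := by
  have hcoprime : IsCoprime (X - C (ξ : ℂ)) (X - C (η : ℂ)) :=
    isCoprime_X_sub_C_of_isUnit_sub (sub_ne_zero.2 (Units.val_injective.ne h)).isUnit
  rw [(block_hasMonodromy η a).classRankHom_eq, polyRank_mulRoot_of_isCoprime hcoprime.pow]

theorem classRankHom_two_mul_block_eq_zero_iff (ξ : ℂˣ) (n m : ℕ) :
    classRankHom p ((X - C (ξ : ℂ)) ^ m) (block p 1 2 * block p ξ (n + 1)) = 0 ↔ n + 2 ≤ m := by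
  rw [((block_hasMonodromy 1 2).mul (block_hasMonodromy ξ (n + 1))).classRankHom_eq_zero_iff]
  exact aeval_map_mulRoot_eq_zero_iff ξ.ne_zero n m

theorem exists_two_mul_block_eq_sum_block (ξ : ℂˣ) (n : ℕ) : ∃ (m : ℕ) (a : Fin m → ℕ),
    block p 1 2 * block p ξ (n + 1) = ∑ i, block p ξ (a i) ∧
      (∀ i, a i ≤ n + 2) ∧ ∃ i, a i = n + 2 := by
  obtain ⟨m, η, a, h⟩ := exists_eq_sum_block (block p 1 2 * block p ξ (n + 1))
  have hrank (k : ℕ) : (∀ i, (X - C (η i : ℂ)) ^ a i ∣ (X - C (ξ : ℂ)) ^ k) ↔ n + 2 ≤ k := by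
    simp only [← classRankHom_two_mul_block_eq_zero_iff (p := p) ξ n k, h, map_sum,
      Finset.sum_eq_zero_iff, Finset.mem_univ, true_imp_iff, classRankHom_block_eq_zero_iff]
  have hsmall (i : Fin m) (hi : a i ≠ 0) : (η i : ℂ) = ξ ∧ a i ≤ n + 2 :=
    eq_of_X_sub_C_pow_dvd_X_sub_C_pow hi ((hrank (n + 2)).2 le_rfl i)
  have hblock (i : Fin m) : block p (η i) (a i) = block p ξ (a i) := by
    by_cases hi : a i = 0
    · rw [hi, block_zero, block_zero]
    · rw [Units.ext (hsmall i hi).1]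
  have hle (i : Fin m) : a i ≤ n + 2 := by
    by_cases hi : a i = 0
    · omega
    · exact (hsmall i hi).2
  refine ⟨m, a, h.trans (Finset.sum_congr rfl fun i _ ↦ hblock i), hle, ?_⟩
  by_contra! hne
  refine absurd ((hrank (n + 1)).1 fun i ↦ ?_) (by omega)
  by_cases hi : a i = 0
  · rw [hi, pow_zero]
    exact one_dvd _
  · rw [(hsmall i hi).1]
    exact pow_dvd_pow _ (by have := hle i; have := hne i; omega)

/-! ### Generation -/

theorem u_eq (ξ : ℂˣ) (a : ℕ) : u p ξ a = baseChangeOf ℂ (block p ξ a) := rfl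

theorem u_zero (ξ : ℂˣ) : u p ξ 0 = 0 := by rw [u_eq, block_zero, map_zero]

theorem u_one_one : u p 1 1 = 1 := by rw [u_eq, block_one_one, map_one]

theorem u_mul_u (ξ η : ℂˣ) : u p ξ 1 * u p η 1 = u p (ξ * η) 1 := by
  rw [u_eq, u_eq, u_eq, ← map_mul, block_mul_block]

theorem span_range_u : Submodule.span ℂ (Set.range fun x : ℂˣ × ℕ ↦ u p x.1 x.2) = ⊤ := by
  rw [eq_top_iff, ← span_range_baseChangeOf ℂ, Submodule.span_le]
  rintro _ ⟨c, rfl⟩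
  obtain ⟨n, ξ, a, rfl⟩ := exists_eq_sum_block c
  rw [map_sum]
  exact Submodule.sum_mem _ fun i _ ↦ Submodule.subset_span ⟨(ξ i, a i), rfl⟩

variable (p) in
/-- The span of the classes of the Jordan blocks with eigenvalue `ξ` and size at most `n`. -/
def blockSpan (ξ : ℂˣ) (n : ℕ) : Submodule ℂ (SplitGrothendieckRing (orbit p)) :=
  Submodule.span ℂ (u p ξ '' Set.Iic n)

theorem u_mem_blockSpan (ξ : ℂˣ) {a n : ℕ} (h : a ≤ n) : u p ξ a ∈ blockSpan p ξ n :=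
  Submodule.subset_span ⟨a, h, rfl⟩

theorem blockSpan_le {ξ : ℂˣ} {n : ℕ} {V : Submodule ℂ (SplitGrothendieckRing (orbit p))} :
    blockSpan p ξ n ≤ V ↔ ∀ a ≤ n, u p ξ a ∈ V :=
  Submodule.span_le.trans Set.image_subset_iff

theorem blockSpan_mono (ξ : ℂˣ) : Monotone (blockSpan p ξ) := fun _ _ h ↦
  blockSpan_le.2 fun _ ha ↦ u_mem_blockSpan ξ (ha.trans h)

theorem exists_two_mul_u_eq (ξ : ℂˣ) (n : ℕ) : ∃ c : ℂ, c ≠ 0 ∧ ∃ y ∈ blockSpan p ξ (n + 1),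
    u p 1 2 * u p ξ (n + 1) = c • u p ξ (n + 2) + y := by
  obtain ⟨m, a, h, ha, i, hi⟩ := exists_two_mul_block_eq_sum_block (p := p) ξ n
  let s : Finset (Fin m) := {i | a i = n + 2}
  refine ⟨s.card, Nat.cast_ne_zero.2 (Finset.card_ne_zero.2 ⟨i, Finset.mem_filter_univ i |>.2 hi⟩),
    ∑ i with ¬a i = n + 2, u p ξ (a i), Submodule.sum_mem _ fun i hi ↦ u_mem_blockSpan ξ ?_, ?_⟩
  · exact Nat.lt_succ_iff.1 ((ha i).lt_of_ne ((Finset.mem_filter_univ i).1 hi))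
  · have hs : ∑ i ∈ s, u p ξ (a i) = (s.card : ℂ) • u p ξ (n + 2) := by
      rw [Nat.cast_smul_eq_nsmul]
      exact Finset.sum_eq_card_nsmul fun i hi ↦ by rw [(Finset.mem_filter_univ i).1 hi]
    rw [← hs, Finset.sum_filter_add_sum_filter_not, u_eq, u_eq, ← map_mul, h, map_sum]
    rfl

theorem two_mul_mem_blockSpan {ξ : ℂˣ} {n : ℕ} {x : SplitGrothendieckRing (orbit p)}
    (hx : x ∈ blockSpan p ξ n) : u p 1 2 * x ∈ blockSpan p ξ (n + 1) := by
  have hle : blockSpan p ξ n ≤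
      (blockSpan p ξ (n + 1)).comap (LinearMap.mulLeft ℂ (u p 1 2)) := by
    refine blockSpan_le.2 fun a ha ↦ ?_
    rw [Submodule.mem_comap, LinearMap.mulLeft_apply]
    cases a with
    | zero => rw [u_zero, mul_zero]; exact Submodule.zero_mem _
    | succ a =>
      obtain ⟨c, -, y, hy, h⟩ := exists_two_mul_u_eq (p := p) ξ a
      rw [h]
      exact Submodule.add_mem _ (Submodule.smul_mem _ c (u_mem_blockSpan ξ (Nat.succ_le_succ ha)))
        (blockSpan_mono ξ (ha.trans n.le_succ) hy)
  exact hle hx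

theorem exists_u_mul_two_pow_eq (ξ : ℂˣ) (n : ℕ) : ∃ c : ℂ, c ≠ 0 ∧ ∃ y ∈ blockSpan p ξ n,
    u p ξ 1 * u p 1 2 ^ n = c • u p ξ (n + 1) + y := by
  induction n with
  | zero => exact ⟨1, one_ne_zero, 0, Submodule.zero_mem _, by simp⟩
  | succ n ih =>
    obtain ⟨c, hc, y, hy, h⟩ := ih
    obtain ⟨d, hd, z, hz, h'⟩ := exists_two_mul_u_eq (p := p) ξ n
    refine ⟨c * d, mul_ne_zero hc hd, c • z + u p 1 2 * y,
      Submodule.add_mem _ (Submodule.smul_mem _ c hz) (two_mul_mem_blockSpan hy), ?_⟩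
    rw [pow_succ', mul_left_comm, h, mul_add, mul_smul_comm, h', smul_add, smul_smul, add_assoc]

theorem u_mul_two_pow_mem_blockSpan (ξ : ℂˣ) (n : ℕ) :
    u p ξ 1 * u p 1 2 ^ n ∈ blockSpan p ξ (n + 1) := by
  obtain ⟨c, -, y, hy, h⟩ := exists_u_mul_two_pow_eq (p := p) ξ n
  rw [h]
  exact Submodule.add_mem _ (Submodule.smul_mem _ c (u_mem_blockSpan ξ le_rfl))
    (blockSpan_mono ξ n.le_succ hy)

variable (p) in
theorem adjoin_generators_eq_top :
    Algebra.adjoin ℂ (Set.range (fun ξ : ℂˣ ↦ u p ξ 1) ∪ {u p 1 2}) = ⊤ := by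
  set A := Algebra.adjoin ℂ (Set.range (fun ξ : ℂˣ ↦ u p ξ 1) ∪ {u p 1 2})
  have hone (ξ : ℂˣ) : u p ξ 1 ∈ A := Algebra.subset_adjoin (Or.inl ⟨ξ, rfl⟩)
  have htwo : u p 1 2 ∈ A := Algebra.subset_adjoin (Or.inr rfl)
  have hle (ξ : ℂˣ) (n : ℕ) : blockSpan p ξ n ≤ A.toSubmodule := by
    induction n with
    | zero =>
      refine blockSpan_le.2 fun a ha ↦ ?_
      rw [Nat.le_zero.1 ha, u_zero]
      exact A.zero_mem
    | succ n ih =>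
      refine blockSpan_le.2 fun a ha ↦ ?_
      obtain ha | rfl := Nat.le_succ_iff.1 ha
      · exact ih (u_mem_blockSpan ξ ha)
      obtain ⟨c, hc, y, hy, h⟩ := exists_u_mul_two_pow_eq (p := p) ξ n
      rw [← Submodule.smul_mem_iff _ hc, eq_sub_of_add_eq h.symm]
      exact A.sub_mem (A.mul_mem (hone ξ) (A.pow_mem htwo n)) (ih hy)
  rw [← Algebra.toSubmodule_eq_top, eq_top_iff, ← span_range_u, Submodule.span_le]
  rintro _ ⟨⟨ξ, a⟩, rfl⟩
  exact hle ξ a (u_mem_blockSpan ξ le_rfl)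

/-! ### Independence -/

variable (p) in
/-- The number of Jordan blocks with eigenvalue `ξ` and size greater than `n`, as the difference
of the ranks of `(F - ξ) ^ n` and `(F - ξ) ^ (n + 1)` for the monodromy `F`. -/
def blockCount (ξ : ℂˣ) (n : ℕ) : SplitGrothendieckRing (orbit p) →ₗ[ℂ] ℂ :=
  baseChangeLift ℂ ((Nat.castAddMonoidHom ℂ).comp (classRankHom p ((X - C (ξ : ℂ)) ^ n)) -
    (Nat.castAddMonoidHom ℂ).comp (classRankHom p ((X - C (ξ : ℂ)) ^ (n + 1))))

theorem blockCount_u (ξ η : ℂˣ) (n a : ℕ) : blockCount p ξ n (u p η a) =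
    (classRankHom p ((X - C (ξ : ℂ)) ^ n) (block p η a) : ℂ) -
      classRankHom p ((X - C (ξ : ℂ)) ^ (n + 1)) (block p η a) :=
  baseChangeLift_baseChangeOf ..

theorem blockCount_u_succ_ne_zero (ξ : ℂˣ) (n : ℕ) : blockCount p ξ n (u p ξ (n + 1)) ≠ 0 := by
  rw [blockCount_u, (classRankHom_block_eq_zero_iff _ ξ (n + 1)).2 dvd_rfl, Nat.cast_zero,
    sub_zero, Nat.cast_ne_zero, Ne, classRankHom_block_eq_zero_iff,
    pow_dvd_pow_iff (X_sub_C_ne_zero _) (not_isUnit_X_sub_C _)]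
  exact n.not_succ_le_self

theorem blockCount_of_mem_blockSpan_of_ne {ξ η : ℂˣ} (h : ξ ≠ η) {k : ℕ} (n : ℕ)
    {x : SplitGrothendieckRing (orbit p)} (hx : x ∈ blockSpan p η k) : blockCount p ξ n x = 0 := by
  have hle : blockSpan p η k ≤ LinearMap.ker (blockCount p ξ n) := blockSpan_le.2 fun a _ ↦ by
    rw [LinearMap.mem_ker, blockCount_u, classRankHom_block_of_ne h, classRankHom_block_of_ne h,
      sub_self]
  exact hle hx

theorem blockCount_of_mem_blockSpan {ξ : ℂˣ} {n : ℕ} {x : SplitGrothendieckRing (orbit p)}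
    (hx : x ∈ blockSpan p ξ n) : blockCount p ξ n x = 0 := by
  have hle : blockSpan p ξ n ≤ LinearMap.ker (blockCount p ξ n) := blockSpan_le.2 fun a ha ↦ by
    rw [LinearMap.mem_ker, blockCount_u,
      (classRankHom_block_eq_zero_iff _ ξ a).2 (pow_dvd_pow _ ha),
      (classRankHom_block_eq_zero_iff _ ξ a).2 (pow_dvd_pow _ (ha.trans n.le_succ)), sub_self]
  exact hle hx

theorem blockCount_u_mul_two_pow_ne_zero (ξ : ℂˣ) (n : ℕ) :
    blockCount p ξ n (u p ξ 1 * u p 1 2 ^ n) ≠ 0 := by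
  obtain ⟨c, hc, y, hy, h⟩ := exists_u_mul_two_pow_eq (p := p) ξ n
  rw [h, map_add, blockCount_of_mem_blockSpan hy, add_zero, map_smul]
  exact smul_ne_zero hc (blockCount_u_succ_ne_zero ξ n)

variable (p) in
/-- The classes `u p ξ 1` as a homomorphism. -/
def uHom : ℂˣ →* SplitGrothendieckRing (orbit p) where
  toFun ξ := u p ξ 1
  map_one' := u_one_one
  map_mul' ξ η := (u_mul_u ξ η).symm

theorem blockCount_lift_mul_two_pow_of_lt (ξ : ℂˣ) {n k : ℕ} (h : k < n)
    (a : MonoidAlgebra ℂ ℂˣ) :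
    blockCount p ξ n (MonoidAlgebra.lift ℂ _ ℂˣ (uHom p) a * u p 1 2 ^ k) = 0 := by
  induction a using MonoidAlgebra.induction_linear with
  | zero => rw [map_zero, zero_mul, map_zero]
  | add a b ha hb => rw [map_add, add_mul, map_add, ha, hb, add_zero]
  | single η c =>
    rw [MonoidAlgebra.lift_single, smul_mul_assoc, map_smul]
    have hmem : uHom p η * u p 1 2 ^ k ∈ blockSpan p η n :=
      blockSpan_mono η h (u_mul_two_pow_mem_blockSpan η k)
    obtain rfl | hne := eq_or_ne ξ η
    · rw [blockCount_of_mem_blockSpan hmem, smul_zero]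
    · rw [blockCount_of_mem_blockSpan_of_ne hne n hmem, smul_zero]

theorem blockCount_lift_mul_two_pow (ξ : ℂˣ) (n : ℕ) (a : MonoidAlgebra ℂ ℂˣ) :
    blockCount p ξ n (MonoidAlgebra.lift ℂ _ ℂˣ (uHom p) a * u p 1 2 ^ n) =
      a.coeff ξ * blockCount p ξ n (u p ξ 1 * u p 1 2 ^ n) := by
  induction a using MonoidAlgebra.induction_linear with
  | zero => simp
  | add a b ha hb =>
    rw [map_add, add_mul, map_add, ha, hb, ← add_mul]
    rfl
  | single η c =>
    rw [MonoidAlgebra.lift_single, smul_mul_assoc, map_smul, MonoidAlgebra.coeff_single]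
    obtain rfl | hne := eq_or_ne ξ η
    · rw [Finsupp.single_eq_same]
      rfl
    · rw [Finsupp.single_eq_of_ne hne, zero_mul]
      exact (congrArg _ (blockCount_of_mem_blockSpan_of_ne hne n
        (u_mul_two_pow_mem_blockSpan η n))).trans (smul_zero c)

/-! ### The isomorphism -/

variable (p) in
/-- The homomorphism to the split Grothendieck ring sending `ξ` to `u p ξ 1` and the variable to
`u p 1 2`. -/
abbrev polyHom : (MonoidAlgebra ℂ ℂˣ)[X] →ₐ[ℂ] SplitGrothendieckRing (orbit p) :=
  monoidPolyLift ℂ (uHom p) (u p 1 2)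

theorem polyHom_surjective : Function.Surjective (polyHom p) := by
  rw [← AlgHom.range_eq_top, ← top_le_iff, ← adjoin_generators_eq_top, Algebra.adjoin_le_iff]
  rintro _ (⟨ξ, rfl⟩ | rfl)
  · exact ⟨_, monoidPolyLift_C_single (uHom p) _ ξ⟩
  · exact ⟨_, monoidPolyLift_X _ _⟩

theorem polyHom_injective : Function.Injective (polyHom p) := by
  refine (injective_iff_map_eq_zero _).2 fun P hP ↦ leadingCoeff_eq_zero.1 ?_
  ext ξ
  have hsum : polyHom p P = ∑ k ∈ Finset.range (P.natDegree + 1),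
      MonoidAlgebra.lift ℂ _ ℂˣ (uHom p) (P.coeff k) * u p 1 2 ^ k := eval₂_eq_sum_range _ _
  have hcount : blockCount p ξ P.natDegree (polyHom p P) =
      P.leadingCoeff.coeff ξ * blockCount p ξ P.natDegree (u p ξ 1 * u p 1 2 ^ P.natDegree) := by
    rw [hsum, Finset.sum_range_succ, map_add, map_sum, Finset.sum_eq_zero fun k hk ↦
      blockCount_lift_mul_two_pow_of_lt ξ (Finset.mem_range.1 hk) _, zero_add,
      blockCount_lift_mul_two_pow, coeff_natDegree]
  rw [hP, map_zero, zero_eq_mul] at hcount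
  exact hcount.resolve_right (blockCount_u_mul_two_pow_ne_zero ξ _)

variable (p) in
/-- `polyHom` as an isomorphism. -/
def polyEquiv : (MonoidAlgebra ℂ ℂˣ)[X] ≃ₐ[ℂ] SplitGrothendieckRing (orbit p) :=
  AlgEquiv.ofBijective (polyHom p) ⟨polyHom_injective, polyHom_surjective⟩

end SkewLaurent

end

theorem theorem5p5 (p : ℕ) [NeZero p] :
    (∀ ξ η : ℂˣ,
      SkewLaurent.u p ξ 1 * SkewLaurent.u p η 1 = SkewLaurent.u p (ξ * η) 1) ∧
    SkewLaurent.u p 1 1 = 1 ∧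
    Algebra.adjoin ℂ (Set.range (fun ξ : ℂˣ ↦ SkewLaurent.u p ξ 1) ∪ {SkewLaurent.u p 1 2}) = ⊤ ∧
    -- the kernel of the map from the free commutative algebra on the generators
    RingHom.ker (MvPolynomial.aeval (R := ℂ)
        (Sum.elim (fun ξ : ℂˣ ↦ SkewLaurent.u p ξ 1) fun _ : Unit ↦ SkewLaurent.u p 1 2)) =
      Ideal.span
        (Set.range (fun x : ℂˣ × ℂˣ ↦
          (MvPolynomial.X (.inl x.1) * MvPolynomial.X (.inl x.2) -
            MvPolynomial.X (.inl (x.1 * x.2)) : MvPolynomial (ℂˣ ⊕ Unit) ℂ)) ∪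
        {MvPolynomial.X (.inl 1) - 1}) ∧
    ∃ Φ : Polynomial (MonoidAlgebra ℂ ℂˣ) ≃ₐ[ℂ]
        SplitGrothendieckRing (SkewLaurent.orbit p),
      (∀ ξ : ℂˣ, Φ (Polynomial.C (MonoidAlgebra.single ξ 1)) = SkewLaurent.u p ξ 1) ∧
      Φ Polynomial.X = SkewLaurent.u p 1 2 :=
  ⟨SkewLaurent.u_mul_u, SkewLaurent.u_one_one, SkewLaurent.adjoin_generators_eq_top p,
    ker_aeval_eq_monoidRelations (φ := SkewLaurent.uHom p) SkewLaurent.polyHom_injective,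
    SkewLaurent.polyEquiv p, monoidPolyLift_C_single (SkewLaurent.uHom p) _, monoidPolyLift_X _ _⟩
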